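/- Let $\mathscr P$ be the set of all integer partitions; for $\lambda\in\mathscr P$ let $|\lambda|$ be its size and $r_m(\lambda)$ the number of parts of $\lambda$ equal to $m$. For $f:\mathscr P\to\mathbb Q$ let $$\langle f\rangle_q=\frac{\sum_{\lambda\in\mathscr P} f(\lambda)q^{|\lambda|}}{\sum_{\lambda\in\mathscr P} q^{|\lambda|}}\in\mathbb Q[[q]],\qquad \deg(f)=\inf\Bigl\{a\in\mathbb R : \lim_{q\to1^-}(1-q)^a\langle f\rangle_q\ \text{converges in }\mathbb R\Bigr\}$$ (where convergence includes that the power series $\langle f\rangle_q$ converges for $0<q<1$), and, when $\deg(f)$ is finite, let the degree limit of $f$ be $\lim_{q\to1^-}(1-q)^{\deg(f)}\langle f\rangle_q\in\mathbb R\cup\{\pm\infty\}$, if it exists. Let $\mathcal F=(f_k)_{k\ge0}$ be a well-normalized polynomial sequence, i.e. $f_k\in\mathbb Q[x]$ has degree $k$ and leading coefficient $\frac1{k!}$, and $f_k(0)=0$ for $k\ge1$. For $k_1\geq 1$, $k_2,\ldots,k_r\ge0$ and $d_1,\ldots,d_r\ge0$ define $P=P_{\mathcal F}$ by $$P(k_1,\ldots,k_r;d_1,\ldots,d_r)(\lambda)=\sum_{m_1>\cdots>m_r>0}\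 \prod_{j=1}^r m_j^{d_j}\,f_{k_j}(r_{m_j}(\lambda)),$$ with $P=1$ if $r=0$. Let $0\le t\le r$, let $d_1,\ldots,d_{t-1}\ge0$ and $d_t\ge1$ (no condition if $t=0$), and let $k_{t+1}\ge2$ and $k_{t+2},\ldots,k_r\ge1$ (no condition if $t=r$). Then $$\deg P(1,\ldots,1,k_{t+1},\ldots,k_r;\,d_1,\ldots,d_t,0,\ldots,0)=\sum_{i=1}^t(d_i+1)+\sum_{i=t+1}^r k_i,$$ and the degree limit of $P(1,\ldots,1,k_{t+1},\ldots,k_r;\,d_1,\ldots,d_t,0,\ldots,0)$ exists and equals $$\xi(d_1,\ldots,d_t)\;\zeta(k_{t+1},\ldots,k_r).$$ Here $$\zeta(k_{t+1},\ldots,k_r)=\sum_{m_{t+1}>\cdots>m_r>0}\frac1{m_{t+1}^{k_{t+1}}\cdots m_r^{k_r}},\qquad \xi(d_1,\ldots,d_t)=\sum_{0<m_1<\cdots<m_t}\frac1{m_1\cdots m_t}\,\Omega\Bigl[\prod_{i=1}^t\Bigl(\frac1{m_i}+\cdots+\frac1{m_t}\Bigr)^{d_i}\Bigr]$$ are convergent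 series, $\Omega$ is the linear map on polynomials in $m_1^{-1},\ldots,m_t^{-1}$ (treated as independent variables) with $\Omega\bigl[m_1^{-l_1}\cdots m_t^{-l_t}\bigr]=l_1!\cdots l_t!\,m_1^{-l_1}\cdots m_t^{-l_t}$, and $\xi$ and $\zeta$ of the empty tuple are $1$. -/

import Mathlib

open Filter Topology

namespace PartitionMZV

/-- The set of all partitions of all nonnegative integers; `⟨n, p⟩` is a partition of size `n`. -/
abbrev Ptn : Type := Σ n : ℕ, n.Partition

/-- `mult m p` is the number of parts of the partition `p` that are equal to `m`. -/
def mult (m : ℕ) (p : Ptn) : ℕ := p.2.parts.count m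

/-- The `q`-bracket `(∑_p f(p) q^|p|) / (∑_p q^|p|)`, a formal power series over `ℚ`. -/
noncomputable def qBracket (f : Ptn → ℚ) : PowerSeries ℚ :=
  PowerSeries.mk (fun n => ∑ p : n.Partition, f ⟨n, p⟩) *
    (PowerSeries.mk (fun n => ∑ _p : n.Partition, (1 : ℚ)))⁻¹

/-- The terms of the `q`-bracket of `f` at a real number `q`. -/
noncomputable def qBracketTerm (f : Ptn → ℚ) (q : ℝ) (n : ℕ) : ℝ :=
  ((PowerSeries.coeff n (qBracket f) : ℚ) : ℝ) * q ^ n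

/-- The value of the `q`-bracket of `f` at a real number `q`. -/
noncomputable def qBracketAt (f : Ptn → ℚ) (q : ℝ) : ℝ := ∑' n, qBracketTerm f q n

/-- The `q`-bracket of `f` is defined on the unit interval, and `(1 - q)^a ⟨f⟩_q` converges to a
real number as `q → 1` from below. -/
def ConvergesWith (f : Ptn → ℚ) (a : ℝ) : Prop :=
  (∀ q : ℝ, 0 < q → q < 1 → Summable (qBracketTerm f q)) ∧
    ∃ l : ℝ, Tendsto (fun q : ℝ => (1 - q) ^ a * qBracketAt f q) (𝓝[<] 1) (𝓝 l)

/-- The degree of `f`: the infimum, in the extended reals, of the exponents `a` for which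
`(1 - q)^a ⟨f⟩_q` converges. -/
noncomputable def degree (f : Ptn → ℚ) : EReal :=
  sInf {x : EReal | ∃ a : ℝ, x = (a : EReal) ∧ ConvergesWith f a}

/-- `L` is the degree limit of `f`: the degree of `f` is a real number `a`, and
`(1 - q)^a ⟨f⟩_q` tends to `L` (in the extended reals) as `q → 1` from below. -/
def IsDegreeLimit (f : Ptn → ℚ) (L : EReal) : Prop :=
  ∃ a : ℝ, degree f = (a : EReal) ∧
    Tendsto (fun q : ℝ => (((1 - q) ^ a * qBracketAt f q : ℝ) : EReal)) (𝓝[<] 1) (𝓝 L)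

/-- A well-normalized polynomial sequence: `F k` has degree `k` and leading coefficient `1 / k!`,
and vanishes at `0` for `k ≥ 1`. -/
structure WellNormalized (F : ℕ → Polynomial ℚ) : Prop where
  natDegree_eq : ∀ k, (F k).natDegree = k
  leadingCoeff_eq : ∀ k, (F k).leadingCoeff = 1 / (Nat.factorial k : ℚ)
  eval_zero : ∀ k, 1 ≤ k → (F k).eval 0 = 0

/-- The tuples `m₁ > ⋯ > m_r > 0`. -/
abbrev DecTuple (r : ℕ) : Type := {m : Fin r → ℕ // StrictAnti m ∧ ∀ i, 0 < m i}

/-- The tuples `0 < m₁ < ⋯ < m_r`. -/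
abbrev IncTuple (r : ℕ) : Type := {m : Fin r → ℕ // StrictMono m ∧ ∀ i, 0 < m i}

/-- The summand of `P` at `m₁ > ⋯ > m_r > 0`. -/
def PTerm (F : ℕ → Polynomial ℚ) {r : ℕ} (k d : Fin r → ℕ) (p : Ptn) (m : DecTuple r) : ℚ :=
  ∏ j, ((m.1 j : ℚ) ^ d j * (F (k j)).eval (mult (m.1 j) p : ℚ))

/-- The partition analogue of multiple zeta values `P_F(k₁, …, k_r; d₁, …, d_r)`. The sum has only
finitely many nonzero terms when `k₁ ≥ 1` (or `r = 0`), see `PTerm_support_finite`. -/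
noncomputable def P (F : ℕ → Polynomial ℚ) {r : ℕ} (k d : Fin r → ℕ) (p : Ptn) : ℚ :=
  ∑ᶠ m : DecTuple r, PTerm F k d p m

/-- The sum that defines `P` is a finite sum. -/
theorem PTerm_support_finite (F : ℕ → Polynomial ℚ) (hF : WellNormalized F) {r : ℕ}
    (k d : Fin r → ℕ) (hk : ∀ i : Fin r, (i : ℕ) = 0 → 1 ≤ k i) (p : Ptn) :
    (Function.support (PTerm F k d p)).Finite := by
  have key : ∀ m ∈ Function.support (PTerm F k d p), ∀ j, m.1 j ≤ p.2.parts.sum := by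
    intro m hm j
    have hr : 0 < r := lt_of_le_of_lt (Nat.zero_le _) j.2
    have h0 := Finset.prod_ne_zero_iff.mp hm ⟨0, hr⟩ (Finset.mem_univ _)
    have hle : m.1 j ≤ m.1 ⟨0, hr⟩ := m.2.1.antitone (Fin.mk_le_of_le_val (Nat.zero_le _))
    refine hle.trans (Multiset.le_sum_of_mem ?_)
    by_contra hmem
    apply h0
    have hz : mult (m.1 ⟨0, hr⟩) p = 0 := Multiset.count_eq_zero_of_notMem hmem
    rw [hz, Nat.cast_zero, hF.eval_zero _ (hk _ rfl), mul_zero]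
  have hfin : (Set.Iic (fun _ : Fin r => p.2.parts.sum)).Finite := Set.finite_Iic _
  exact Set.Finite.subset (hfin.preimage Subtype.val_injective.injOn) (fun m hm j => key m hm j)

/-- The summand of the multiple zeta value at `m₁ > ⋯ > m_r > 0`. -/
noncomputable def zetaTerm {r : ℕ} (k : Fin r → ℕ) (m : DecTuple r) : ℝ :=
  ∏ i, 1 / (m.1 i : ℝ) ^ k i

/-- The multiple zeta value `ζ(k₁, …, k_r)`; it is `1` for `r = 0`. -/
noncomputable def zeta {r : ℕ} (k : Fin r → ℕ) : ℝ := ∑' m : DecTuple r, zetaTerm k m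

/-- The linear map `Ω` on polynomials in the variables `1/m₁, …, 1/m_r` which multiplies the
monomial with exponents `l₁, …, l_r` by `l₁! ⋯ l_r!`. -/
noncomputable def Omega (r : ℕ) : MvPolynomial (Fin r) ℚ →ₗ[ℚ] MvPolynomial (Fin r) ℚ :=
  (MvPolynomial.basisMonomials (Fin r) ℚ).constr ℚ
    (fun l => MvPolynomial.monomial l (∏ i, (Nat.factorial (l i) : ℚ)))

/-- The summand of the conjugated multiple zeta value at `0 < m₁ < ⋯ < m_r`; the variable `X i`
stands for `1 / m_i`. -/
noncomputable def xiTerm {r : ℕ} (d : Fin r → ℕ) (m : IncTuple r) : ℝ :=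
  (∏ i, 1 / (m.1 i : ℝ)) *
    MvPolynomial.aeval (fun i => 1 / (m.1 i : ℝ))
      (Omega r (∏ i, (∑ j ∈ Finset.Ici i, (MvPolynomial.X j : MvPolynomial (Fin r) ℚ)) ^ d i))

/-- The conjugated multiple zeta value `ξ(d₁, …, d_r)`; it is `1` for `r = 0`. -/
noncomputable def xi {r : ℕ} (d : Fin r → ℕ) : ℝ := ∑' m : IncTuple r, xiTerm d m

end PartitionMZV

namespace PartitionMZV

/-! Since `F k` vanishes at `0` for `k ≥ 1`, each factor telescopes into increments `f (c + 1) - f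
c` over `c < r_m`. Multiplied out, `P` becomes a sum of weights over pairs `(m, c)` such that the
partition contains `c_j + 1` copies of every `m_j`. Removing these parts is a bijection onto the
partitions of a smaller number, so division by the partition generating function leaves the sum of
`weight * q ^ size` over all `(m, c)` (`qBracket_P`, `hasSum_qBracketTerm_P`).

For the last `s` entries, the sum over `c` gives `incrSum`, and the normalization makes `(1 - q)^k *
incrSum (q^m)` tend to `1 / m^k` (`tendsto_incrSum`). For the first `t` entries, `F 1 = X` has
increments `1`. They are described by their gaps `u` above the largest remaining entry `M`.
Conjugating the partition (`sum_tailSum_mul`) turns the exponent of `q`, for `M = 0`, into a sum of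
`n_i * (u_i + 1)`, where the `n_i` are partial sums of the multiplicities. The sum over `u` then
factorizes monomial by monomial, and `∑ u^l q^(n u) ~ l! / (n (1 - q))^(l + 1)` yields both the
factorials of `Omega` and the increasing indices `n_i` of `xi`. The value of `M` is lost in the
limit (`tendsto_tsum_headTerm`), so the two blocks decouple into `xi * zeta`.

The limits pass through the sums by dominated convergence, over `c` and then over `m`, with
majorants from `one_sub_pow_mul_le`. These converge because the largest index carries an extra
power, which is where `d_t ≥ 1` and `k_{t+1} ≥ 2` enter. The limit is positive, so its exponent is
the degree (`degree_eq_of_tendsto`). -/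

/-! ### Factorization of series over finite products -/

theorem summable_and_tsum_pi_prod {α : Type*} {n : ℕ} (f : Fin n → α → ℝ)
    (hf : ∀ i, Summable fun a => ‖f i a‖) :
    (Summable fun x : Fin n → α => ‖∏ i, f i (x i)‖) ∧
      ∑' x : Fin n → α, ∏ i, f i (x i) = ∏ i, ∑' a, f i a := by
  induction n with
  | zero =>
    refine ⟨(hasSum_fintype _).summable, ?_⟩
    simp
  | succ n ih =>
    obtain ⟨h1, h2⟩ := ih (fun i => f i.succ) (fun i => hf _)
    have hs := summable_mul_of_summable_norm (hf 0) h1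
    have hs' := (hf 0).mul_norm h1
    constructor
    · rw [← (Fin.consEquiv fun _ => α).summable_iff]
      refine hs'.congr fun x => ?_
      simp [Fin.prod_univ_succ]
    · rw [← (Fin.consEquiv fun _ => α).tsum_eq, Fin.prod_univ_succ, ← h2,
        tsum_mul_tsum_of_summable_norm (hf 0) h1]
      refine tsum_congr fun x => ?_
      simp [Fin.prod_univ_succ]

theorem summable_pi_prod {α : Type*} {n : ℕ} (f : Fin n → α → ℝ)
    (hf : ∀ i, Summable fun a => ‖f i a‖) :
    Summable fun x : Fin n → α => ∏ i, f i (x i) :=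
  (summable_and_tsum_pi_prod f hf).1.of_norm

/-! ### One-variable series as `q → 1`: limits and uniform bounds -/

/-- The series `∑ n^l x^n` over `n ≥ 1`. -/
noncomputable def powSum (l : ℕ) (x : ℝ) : ℝ := ∑' c : ℕ, ((c : ℝ) + 1) ^ l * x ^ (c + 1)

theorem summable_powSum (l : ℕ) {x : ℝ} (h0 : 0 < x) (h1 : x < 1) :
    Summable fun c : ℕ => ((c : ℝ) + 1) ^ l * x ^ (c + 1) := by
  have h := (summable_nat_add_iff 1).mpr
    (summable_pow_mul_geometric_of_norm_lt_one (R := ℝ) l (r := x)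
      (by rwa [Real.norm_of_nonneg h0.le]))
  simpa using h

theorem powSum_nonneg (l : ℕ) {x : ℝ} (h0 : 0 < x) : 0 ≤ powSum l x :=
  tsum_nonneg fun c => by positivity

/-- Coefficientwise, `n^l ≤ n (n + 1) ⋯ (n + l - 1)`, and the series with rising factorials is a
negative binomial series. -/
theorem powSum_le (l : ℕ) {x : ℝ} (h0 : 0 < x) (h1 : x < 1) :
    powSum l x ≤ l.factorial * (x / (1 - x) ^ (l + 1)) := by
  have hs := (hasSum_choose_mul_geometric_of_norm_lt_one (𝕜 := ℝ) l (r := x)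
    (by rwa [Real.norm_of_nonneg h0.le])).mul_left ((l.factorial : ℝ) * x)
  rw [mul_div_assoc', ← mul_one_div]
  refine hasSum_le ?_ (summable_powSum l h0 h1).hasSum hs
  intro c
  have h : (c + 1) ^ l ≤ l.factorial * (c + l).choose l := by
    rw [← Nat.ascFactorial_eq_factorial_mul_choose]
    exact Nat.pow_succ_le_ascFactorial _ _
  have h' : ((c : ℝ) + 1) ^ l ≤ l.factorial * (c + l).choose l := by exact_mod_cast h
  calc ((c : ℝ) + 1) ^ l * x ^ (c + 1) ≤ (l.factorial * (c + l).choose l) * x ^ (c + 1) := by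
        gcongr
    _ = _ := by ring

theorem le_powSum (l : ℕ) {x : ℝ} (h0 : 0 < x) (h1 : x < 1) :
    l.factorial * (x ^ (l + 1) / (1 - x) ^ (l + 1)) ≤ powSum l x := by
  have hs := (hasSum_choose_mul_geometric_of_norm_lt_one (𝕜 := ℝ) l (r := x)
    (by rwa [Real.norm_of_nonneg h0.le])).mul_left ((l.factorial : ℝ) * x ^ (l + 1))
  rw [mul_div_assoc', ← mul_one_div, ← hs.tsum_eq]
  have hp := summable_powSum l h0 h1
  -- The first `l` terms are dropped: from there on, `n^l` dominates the falling factorial `(n - 1)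
  -- ⋯ (n - l)`.
  refine le_trans (Summable.tsum_le_tsum (g := fun c : ℕ =>
      (((c + l : ℕ) : ℝ) + 1) ^ l * x ^ (c + l + 1)) ?_ hs.summable
      ((summable_nat_add_iff l).mpr hp)) ?_
  · intro c
    have h : l.factorial * (c + l).choose l ≤ (c + l + 1) ^ l := by
      rw [← Nat.descFactorial_eq_factorial_mul_choose]
      exact (Nat.descFactorial_le_pow _ _).trans (Nat.pow_le_pow_left (Nat.le_succ _) _)
    have h' : (l.factorial : ℝ) * (c + l).choose l ≤ (((c + l : ℕ) : ℝ) + 1) ^ l := by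
      exact_mod_cast h
    calc _ = ((l.factorial : ℝ) * (c + l).choose l) * x ^ (c + l + 1) := by ring
      _ ≤ _ := by gcongr
  · exact tsum_comp_le_tsum_of_inj hp (fun c => by positivity) (add_left_injective l)

theorem eventually_mem_Ioo : ∀ᶠ q : ℝ in 𝓝[<] 1, 0 < q ∧ q < 1 :=
  Ioo_mem_nhdsLT one_pos

theorem one_sub_le_mul {p : ℝ} (h0 : 0 < p) (k : ℕ) : 1 - p ^ k ≤ k * (1 - p) := by
  have := one_add_mul_le_pow (a := p - 1) (by linarith) k
  simp only [add_sub_cancel] at this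
  linarith

/-- With `q = p^k` the left side is a perfect `k`-th power, and Bernoulli's inequality at `p` and at
`p⁻¹` bounds its base by `k / m`. Uniformity in `q` is what makes this usable for domination. -/
theorem one_sub_pow_mul_le {q : ℝ} (h0 : 0 < q) (h1 : q < 1) {k m : ℕ} (hk : 1 ≤ k)
    (hm : 1 ≤ m) :
    (1 - q) ^ k * (q ^ m / (1 - q ^ m) ^ k) ≤ (k : ℝ) ^ k * (1 / (m : ℝ) ^ k) := by
  obtain ⟨p, hp0, hp1, rfl⟩ : ∃ p : ℝ, 0 < p ∧ p < 1 ∧ p ^ k = q := by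
    refine ⟨q ^ ((k : ℝ)⁻¹), Real.rpow_pos_of_pos h0 _,
      Real.rpow_lt_one h0.le h1 (by positivity), Real.rpow_inv_natCast_pow h0.le (by omega)⟩
  have hm0 : (0 : ℝ) < m := by exact_mod_cast hm
  have hpm : p ^ m < 1 := pow_lt_one₀ hp0.le hp1 (by omega)
  have hpk : p ^ k < 1 := pow_lt_one₀ hp0.le hp1 (by omega)
  have hkm : (p ^ k) ^ m ≤ p ^ m := by
    rw [← pow_mul]
    exact pow_le_pow_of_le_one hp0.le hp1.le (Nat.le_mul_of_pos_left _ hk)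
  have hden : 0 < 1 - (p ^ k) ^ m := by linarith
  have key : (1 - p) * p ^ m / (1 - p ^ m) ≤ 1 / m := by
    rw [div_le_div_iff₀ (by linarith) hm0]
    have h := one_sub_le_mul (p := p⁻¹) (by positivity) m
    have h2 : p ^ m * (1 - p⁻¹ ^ m) ≤ p ^ m * (m * (1 - p⁻¹)) := by gcongr
    have h3 : p ^ m * p⁻¹ ^ m = 1 := by rw [← mul_pow, mul_inv_cancel₀ hp0.ne', one_pow]
    have h4 : 1 - p ≤ p⁻¹ - 1 := by
      have : p * p⁻¹ = 1 := mul_inv_cancel₀ hp0.ne'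
      nlinarith [sq_nonneg (p⁻¹ - 1), inv_pos.mpr hp0]
    have h5 : p ^ m * m * (1 - p) ≤ p ^ m * m * (p⁻¹ - 1) := by gcongr
    nlinarith
  calc (1 - p ^ k) ^ k * ((p ^ k) ^ m / (1 - (p ^ k) ^ m) ^ k)
      = ((1 - p ^ k) * p ^ m / (1 - (p ^ k) ^ m)) ^ k := by
        rw [div_pow, mul_pow, mul_div_assoc', pow_right_comm p m k]
    _ ≤ ((k * (1 - p)) * p ^ m / (1 - p ^ m)) ^ k := by
        have := one_sub_le_mul hp0 k
        have h1k : 0 ≤ 1 - p ^ k := by linarith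
        have : 0 < 1 - p ^ m := by linarith
        gcongr
    _ = ((k : ℝ) * ((1 - p) * p ^ m / (1 - p ^ m))) ^ k := by ring
    _ ≤ ((k : ℝ) * (1 / m)) ^ k := by
        have : 0 ≤ (1 - p) * p ^ m / (1 - p ^ m) := by
          have : 0 < 1 - p ^ m := by linarith
          have : 0 < 1 - p := by linarith
          positivity
        gcongr
    _ = _ := by rw [mul_pow, one_div_pow]

theorem tendsto_one_sub_div {m : ℕ} (hm : 1 ≤ m) :
    Tendsto (fun q : ℝ => (1 - q) / (1 - q ^ m)) (𝓝[<] 1) (𝓝 (1 / m)) := by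
  have h : Tendsto (fun q : ℝ => 1 / ∑ i ∈ Finset.range m, q ^ i) (𝓝[<] 1) (𝓝 (1 / m)) := by
    have hc : Tendsto (fun q : ℝ => ∑ i ∈ Finset.range m, q ^ i) (𝓝[<] 1) (𝓝 m) := by
      have : Continuous (fun q : ℝ => ∑ i ∈ Finset.range m, q ^ i) := by fun_prop
      simpa using (this.tendsto 1).mono_left nhdsWithin_le_nhds
    exact tendsto_const_nhds.div hc (by positivity)
  refine h.congr' ?_
  filter_upwards [eventually_mem_Ioo] with q hq
  have hq1 : (1 - q) ≠ 0 := by linarith [hq.2]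
  rw [← mul_neg_geom_sum, div_mul_eq_div_div, div_self hq1]

theorem tendsto_powSum {l m : ℕ} (hm : 1 ≤ m) :
    Tendsto (fun q : ℝ => (1 - q) ^ (l + 1) * powSum l (q ^ m)) (𝓝[<] 1)
      (𝓝 (l.factorial * (1 / (m : ℝ) ^ (l + 1)))) := by
  have hr := (tendsto_one_sub_div hm).pow (l + 1)
  rw [one_div_pow] at hr
  have hq : ∀ n : ℕ, Tendsto (fun q : ℝ => (q ^ m) ^ n) (𝓝[<] 1) (𝓝 1) := fun n => by
    have : Continuous (fun q : ℝ => (q ^ m) ^ n) := by fun_prop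
    simpa using (this.tendsto 1).mono_left nhdsWithin_le_nhds
  have hlo := ((hq (l + 1)).mul hr).const_mul (l.factorial : ℝ)
  have hhi := ((hq 1).mul hr).const_mul (l.factorial : ℝ)
  rw [one_mul] at hlo hhi
  refine tendsto_of_tendsto_of_tendsto_of_le_of_le' hlo hhi ?_ ?_
  · filter_upwards [eventually_mem_Ioo] with q ⟨h0, h1⟩
    have h2 := le_powSum l (x := q ^ m) (by positivity) (pow_lt_one₀ h0.le h1 (by omega))
    have h3 : 0 ≤ (1 - q) ^ (l + 1) := pow_nonneg (by linarith) _
    refine le_trans (le_of_eq ?_) (mul_le_mul_of_nonneg_left h2 h3)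
    rw [div_pow]; ring
  · filter_upwards [eventually_mem_Ioo] with q ⟨h0, h1⟩
    have h2 := powSum_le l (x := q ^ m) (by positivity) (pow_lt_one₀ h0.le h1 (by omega))
    have h3 : 0 ≤ (1 - q) ^ (l + 1) := pow_nonneg (by linarith) _
    refine le_trans (mul_le_mul_of_nonneg_left h2 h3) (le_of_eq ?_)
    rw [div_pow]; ring

theorem one_sub_pow_mul_powSum_le (l : ℕ) {m : ℕ} (hm : 1 ≤ m) {q : ℝ} (h0 : 0 < q) (h1 : q < 1) :
    (1 - q) ^ (l + 1) * powSum l (q ^ m) ≤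
      (l.factorial * ((l + 1 : ℕ) : ℝ) ^ (l + 1)) * (1 / (m : ℝ) ^ (l + 1)) := by
  have h2 := powSum_le l (x := q ^ m) (by positivity) (pow_lt_one₀ h0.le h1 (by omega))
  have h3 : 0 ≤ (1 - q) ^ (l + 1) := pow_nonneg (by linarith) _
  have h4 := one_sub_pow_mul_le h0 h1 (k := l + 1) (by omega) hm
  calc _ ≤ (1 - q) ^ (l + 1) * (l.factorial * (q ^ m / (1 - q ^ m) ^ (l + 1))) := by gcongr
    _ = l.factorial * ((1 - q) ^ (l + 1) * (q ^ m / (1 - q ^ m) ^ (l + 1))) := by ring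
    _ ≤ l.factorial * (((l + 1 : ℕ) : ℝ) ^ (l + 1) * (1 / (m : ℝ) ^ (l + 1))) := by gcongr
    _ = _ := by ring

/-- The increment `f(c + 1) - f(c)` of a rational polynomial, as a real number. -/
noncomputable def incr (f : Polynomial ℚ) (c : ℕ) : ℝ :=
  ((f.eval ((c : ℚ) + 1) - f.eval (c : ℚ) : ℚ) : ℝ)

/-- The series `∑ (f(n) - f(n-1)) x^n` over `n ≥ 1`. -/
noncomputable def incrSum (f : Polynomial ℚ) (x : ℝ) : ℝ := ∑' c : ℕ, incr f c * x ^ (c + 1)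

theorem hasSum_eval_mul_pow (f : Polynomial ℚ) {x : ℝ} (h0 : 0 < x) (h1 : x < 1) :
    HasSum (fun c : ℕ => ((f.eval ((c : ℚ) + 1) : ℚ) : ℝ) * x ^ (c + 1))
      (∑ i ∈ Finset.range (f.natDegree + 1), (f.coeff i : ℝ) * powSum i x) := by
  have h : ∀ i ∈ Finset.range (f.natDegree + 1),
      HasSum (fun c : ℕ => (f.coeff i : ℝ) * (((c : ℝ) + 1) ^ i * x ^ (c + 1)))
        ((f.coeff i : ℝ) * powSum i x) :=
    fun i _ => (summable_powSum i h0 h1).hasSum.mul_left _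
  refine (hasSum_sum h).congr_fun ?_
  intro c
  rw [Polynomial.eval_eq_sum_range, Rat.cast_sum, Finset.sum_mul]
  refine Finset.sum_congr rfl fun i _ => ?_
  push_cast
  ring

theorem summable_norm_eval_mul_pow (f : Polynomial ℚ) {x : ℝ} (h0 : 0 < x) (h1 : x < 1) :
    Summable fun c : ℕ => ‖((f.eval (c : ℚ) : ℚ) : ℝ) * x ^ c‖ :=
  (summable_nat_add_iff 1).mp <| by
    simpa using (hasSum_eval_mul_pow f h0 h1).summable.norm

theorem summable_norm_incr (f : Polynomial ℚ) {x : ℝ} (h0 : 0 < x) (h1 : x < 1) :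
    Summable fun c : ℕ => ‖incr f c * x ^ (c + 1)‖ := by
  refine .of_nonneg_of_le (fun _ => norm_nonneg _) ?_
    ((hasSum_eval_mul_pow f h0 h1).summable.norm.add
      ((summable_norm_eval_mul_pow f h0 h1).mul_left x))
  intro c
  rw [incr, Rat.cast_sub, sub_mul]
  refine (norm_sub_le _ _).trans (le_of_eq ?_)
  simp only [norm_mul, norm_pow, Real.norm_of_nonneg h0.le, pow_succ]
  ring

/-- Summation by parts; the condition at `0` removes the boundary term. -/
theorem incrSum_eq (f : Polynomial ℚ) (hf : f.eval 0 = 0) {x : ℝ} (h0 : 0 < x) (h1 : x < 1) :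
    incrSum f x = (1 - x) *
      ∑ i ∈ Finset.range (f.natDegree + 1), (f.coeff i : ℝ) * powSum i x := by
  have h := hasSum_eval_mul_pow f h0 h1
  have h' : HasSum (fun c : ℕ => ((f.eval (c : ℚ) : ℚ) : ℝ) * x ^ c)
      (∑ i ∈ Finset.range (f.natDegree + 1), (f.coeff i : ℝ) * powSum i x) := by
    rw [← hasSum_nat_add_iff' 1]
    simpa [hf] using h
  rw [sub_mul, one_mul]
  refine ((h.sub (h'.mul_left x)).congr_fun ?_).tsum_eq
  intro c
  rw [incr]
  push_cast
  ring

theorem tendsto_incrSum (f : Polynomial ℚ) (hf : f.eval 0 = 0) {m : ℕ} (hm : 1 ≤ m) :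
    Tendsto (fun q : ℝ => (1 - q) ^ f.natDegree * incrSum f (q ^ m)) (𝓝[<] 1)
      (𝓝 ((f.natDegree.factorial * f.leadingCoeff : ℚ) * (1 / (m : ℝ) ^ f.natDegree))) := by
  have hm0 : (m : ℝ) ≠ 0 := by positivity
  set k := f.natDegree with hk
  have hr : Tendsto (fun q : ℝ => (1 - q ^ m) / (1 - q)) (𝓝[<] 1) (𝓝 m) := by
    have := (tendsto_one_sub_div hm).inv₀ (by positivity)
    simpa using this
  have hpow : ∀ n : ℕ, Tendsto (fun q : ℝ => (1 - q) ^ n) (𝓝[<] 1) (𝓝 (0 ^ n)) := fun n => by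
    have : Continuous (fun q : ℝ => (1 - q) ^ n) := by fun_prop
    simpa using (this.tendsto 1).mono_left nhdsWithin_le_nhds
  have h := tendsto_finsetSum (Finset.range (k + 1)) fun i _ =>
    ((hr.mul (hpow (k - i))).mul (tendsto_powSum (l := i) hm)).const_mul (f.coeff i : ℝ)
  rw [Finset.sum_eq_single_of_mem k (by simp)] at h
  · refine (h.congr' ?_).trans (le_of_eq ?_)
    · filter_upwards [eventually_mem_Ioo] with q ⟨h0, h1⟩
      rw [incrSum_eq f hf (by positivity) (pow_lt_one₀ h0.le h1 (by omega)), Finset.mul_sum,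
        Finset.mul_sum]
      refine Finset.sum_congr rfl fun i hi => ?_
      have hq1 : (1 - q) ≠ 0 := by linarith
      have hik : k = (k - i) + i := by have := Finset.mem_range.mp hi; omega
      have hp : (1 - q) ^ k = (1 - q) ^ (k - i) * (1 - q) ^ i := by rw [← pow_add, ← hik]
      rw [hp, pow_succ]
      field_simp
    · rw [Polynomial.leadingCoeff, ← hk]
      push_cast
      congr 1
      rw [Nat.sub_self, pow_zero, pow_succ]
      field_simp
  -- Monomials below the top degree keep a positive power of `1 - q` and vanish in the limit.
  · intro i hi hik
    have : k - i ≠ 0 := by have := Finset.mem_range.mp hi; omega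
    simp [this]

theorem exists_incrSum_le (f : Polynomial ℚ) (hf : f.eval 0 = 0) (hk : 1 ≤ f.natDegree) :
    ∃ C : ℝ, 0 ≤ C ∧ ∀ m : ℕ, 1 ≤ m → ∀ q : ℝ, 0 < q → q < 1 →
      ‖(1 - q) ^ f.natDegree * incrSum f (q ^ m)‖ ≤ C * (1 / (m : ℝ) ^ f.natDegree) := by
  set k := f.natDegree with hk'
  refine ⟨(∑ i ∈ Finset.range (k + 1), |(f.coeff i : ℝ)| * i.factorial) * (k : ℝ) ^ k,
    by positivity, fun m hm q h0 h1 => ?_⟩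
  have hx0 : 0 < q ^ m := by positivity
  have hx1 : q ^ m < 1 := pow_lt_one₀ h0.le h1 (by omega)
  have hx2 : 0 < 1 - q ^ m := by linarith
  have hq2 : 0 < 1 - q := by linarith
  rw [incrSum_eq f hf hx0 hx1, ← hk', norm_mul, norm_mul, norm_pow, Real.norm_of_nonneg hq2.le,
    Real.norm_of_nonneg hx2.le]
  have hb := one_sub_pow_mul_le h0 h1 hk hm
  have hsum : ‖∑ i ∈ Finset.range (k + 1), (f.coeff i : ℝ) * powSum i (q ^ m)‖ ≤
      (∑ i ∈ Finset.range (k + 1), |(f.coeff i : ℝ)| * i.factorial) *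
        (q ^ m / (1 - q ^ m) ^ (k + 1)) := by
    rw [Finset.sum_mul]
    refine norm_sum_le_of_le _ fun i hi => ?_
    rw [norm_mul, Real.norm_eq_abs, Real.norm_of_nonneg (powSum_nonneg i hx0), mul_assoc]
    have hik : i + 1 ≤ k + 1 := Finset.mem_range.mp hi
    have : (1 - q ^ m) ^ (k + 1) ≤ (1 - q ^ m) ^ (i + 1) :=
      pow_le_pow_of_le_one hx2.le (by linarith) hik
    have h2 := powSum_le i hx0 hx1
    refine mul_le_mul_of_nonneg_left (h2.trans ?_) (abs_nonneg _)
    gcongr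
  calc _ ≤ (1 - q) ^ k * ((1 - q ^ m) *
        ((∑ i ∈ Finset.range (k + 1), |(f.coeff i : ℝ)| * i.factorial) *
          (q ^ m / (1 - q ^ m) ^ (k + 1)))) := by gcongr
    _ = (∑ i ∈ Finset.range (k + 1), |(f.coeff i : ℝ)| * i.factorial) *
          ((1 - q) ^ k * (q ^ m / (1 - q ^ m) ^ k)) := by
        rw [pow_succ]; field_simp
    _ ≤ (∑ i ∈ Finset.range (k + 1), |(f.coeff i : ℝ)| * i.factorial) *
          ((k : ℝ) ^ k * (1 / (m : ℝ) ^ k)) := by gcongr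
    _ = _ := by ring

/-! ### A convergence criterion for sums over tuples -/

/-- This shares the factor `1 / N` equally among the `r` variables, raising each exponent from `1`
to `1 + 1 / r`. -/
theorem one_div_le_prod_rpow {r : ℕ} {m : Fin r → ℕ} {N : ℕ} (hm : ∀ i, 0 < m i)
    (hN : ∀ i, m i ≤ N) (hr : 0 < r) :
    1 / (N : ℝ) ≤ ∏ i, (m i : ℝ) ^ (-(1 / r : ℝ)) := by
  have hN0 : 0 < N := (hm ⟨0, hr⟩).trans_le (hN _)
  have hr' : (r : ℝ) ≠ 0 := by positivity
  calc 1 / (N : ℝ) = ∏ _i : Fin r, (N : ℝ) ^ (-(1 / r : ℝ)) := by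
        rw [Finset.prod_const, Finset.card_univ, Fintype.card_fin, ← Real.rpow_mul_natCast
          (by positivity), neg_mul, one_div_mul_cancel hr', Real.rpow_neg_one, one_div]
    _ ≤ _ := by
        refine Finset.prod_le_prod (fun i _ => by positivity) fun i _ => ?_
        refine Real.rpow_le_rpow_of_nonpos (by exact_mod_cast hm i) (by exact_mod_cast hN i) ?_
        rw [neg_nonpos]; positivity

/-- Over tuples of positive integers bounded by `N m`, the series `∑ 1 / (m₁ ⋯ m_r N)` converges. -/
theorem summable_prod_one_div_mul {ι : Type*} {r : ℕ} (hr : 0 < r) (m : ι → Fin r → ℕ)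
    (hinj : Function.Injective m) (hm : ∀ x i, 0 < m x i) (N : ι → ℕ) (hN : ∀ x i, m x i ≤ N x) :
    Summable fun x => (∏ i, 1 / (m x i : ℝ)) * (1 / (N x : ℝ)) := by
  have h1 : Summable fun n : ℕ => ‖(n : ℝ) ^ (-(1 + 1 / r : ℝ))‖ := by
    have : Summable fun n : ℕ => (n : ℝ) ^ (-(1 + 1 / r : ℝ)) := by
      rw [Real.summable_nat_rpow]
      have : (0 : ℝ) < 1 / r := by positivity
      linarith
    exact this.norm
  have h2 := (summable_pi_prod (fun _ : Fin r => fun n : ℕ => (n : ℝ) ^ (-(1 + 1 / r : ℝ)))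
    (fun _ => h1)).comp_injective hinj
  refine .of_nonneg_of_le (fun x => by positivity) (fun x => ?_) h2
  calc _ ≤ (∏ i, 1 / (m x i : ℝ)) * ∏ i, (m x i : ℝ) ^ (-(1 / r : ℝ)) := by
        gcongr
        exact one_div_le_prod_rpow (hm x) (hN x) hr
    _ = _ := by
        rw [← Finset.prod_mul_distrib]
        refine Finset.prod_congr rfl fun i _ => ?_
        have : (0 : ℝ) < m x i := by exact_mod_cast hm x i
        rw [neg_add, Real.rpow_add this, Real.rpow_neg_one, one_div]

/-! ### Expansion of the `q`-bracket over tuples with multiplicities -/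

/-- Pairs of a tuple `m₁ > ⋯ > m_r > 0` and a tuple of positive multiplicities `c_j + 1`. -/
abbrev MultTuple (r : ℕ) : Type := DecTuple r × (Fin r → ℕ)

/-- The size of the partition with `c_j + 1` parts equal to `m_j`. -/
def size {r : ℕ} (x : MultTuple r) : ℕ := ∑ j, x.1.1 j * (x.2 j + 1)

/-- The parts of the partition with `c_j + 1` parts equal to `m_j`. -/
def partsOf {r : ℕ} (x : MultTuple r) : Multiset ℕ :=
  ∑ j, Multiset.replicate (x.2 j + 1) (x.1.1 j)

/-- The weight of `(m, c)` in the expansion of the `q`-bracket of `P`. -/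
def weight (F : ℕ → Polynomial ℚ) {r : ℕ} (k d : Fin r → ℕ) (x : MultTuple r) : ℚ :=
  ∏ j, ((x.1.1 j : ℚ) ^ d j *
    ((F (k j)).eval ((x.2 j : ℚ) + 1) - (F (k j)).eval (x.2 j : ℚ)))

theorem sum_partsOf {r : ℕ} (x : MultTuple r) : (partsOf x).sum = size x := by
  rw [partsOf, size, Multiset.sum_sum]
  exact Finset.sum_congr rfl fun j _ => by rw [Multiset.sum_replicate, smul_eq_mul, mul_comm]

theorem pos_of_mem_partsOf {r : ℕ} (x : MultTuple r) {i : ℕ} (hi : i ∈ partsOf x) : 0 < i := by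
  simp only [partsOf, Multiset.mem_sum, Finset.mem_univ, true_and] at hi
  obtain ⟨j, hj⟩ := hi
  rw [Multiset.eq_of_mem_replicate hj]
  exact x.1.2.2 j

theorem count_partsOf {r : ℕ} (x : MultTuple r) (j : Fin r) :
    (partsOf x).count (x.1.1 j) = x.2 j + 1 := by
  rw [partsOf, Multiset.count_sum', Finset.sum_eq_single j]
  · simp
  · intro i _ hij
    rw [Multiset.count_replicate, if_neg]
    exact fun h => hij (x.1.2.1.injective h)
  · simp

theorem partsOf_le_iff {r : ℕ} (x : MultTuple r) (s : Multiset ℕ) :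
    partsOf x ≤ s ↔ ∀ j, x.2 j < s.count (x.1.1 j) := by
  rw [Multiset.le_iff_count]
  constructor
  · intro h j
    have := h (x.1.1 j)
    rw [count_partsOf] at this
    omega
  · intro h a
    by_cases ha : a ∈ partsOf x
    · simp only [partsOf, Multiset.mem_sum, Finset.mem_univ, true_and] at ha
      obtain ⟨j, hj⟩ := ha
      rw [Multiset.eq_of_mem_replicate hj, count_partsOf]
      exact h j
    · rw [Multiset.count_eq_zero_of_notMem ha]
      exact Nat.zero_le _

/-- Adding the parts `s` identifies the partitions of `n - |s|` with those of `n` containing `s`. -/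
theorem card_partitions_ge {n : ℕ} (s : Multiset ℕ) (hs : ∀ i ∈ s, 0 < i) :
    (Finset.univ.filter fun p : n.Partition => s ≤ p.parts).card =
      if s.sum ≤ n then Fintype.card (n - s.sum).Partition else 0 := by
  split_ifs with h
  · symm
    refine Finset.card_bij (s := Finset.univ)
      (fun p _ => (⟨p.parts + s, ?_, ?_⟩ : n.Partition)) ?_ ?_ ?_
    · intro i hi
      rcases Multiset.mem_add.mp hi with hi | hi
      exacts [p.parts_pos hi, hs i hi]
    · rw [Multiset.sum_add, p.parts_sum]; omega
    · intro p _; simp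
    · intro p _ p' _ hpp
      have := congrArg Nat.Partition.parts hpp
      exact Nat.Partition.ext (add_right_cancel this)
    · intro p hp
      have hp' : s ≤ p.parts := (Finset.mem_filter.mp hp).2
      refine ⟨⟨p.parts - s, fun hi => p.parts_pos (Multiset.mem_of_le (Multiset.sub_le_self _ _) hi),
        ?_⟩, Finset.mem_univ _, ?_⟩
      · have := congrArg Multiset.sum (Multiset.sub_add_cancel hp')
        rw [Multiset.sum_add, p.parts_sum] at this
        omega
      · exact Nat.Partition.ext (Multiset.sub_add_cancel hp')
  · rw [Finset.card_eq_zero, Finset.filter_eq_empty_iff]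
    intro p _ hsp
    apply h
    obtain ⟨u, hu⟩ := Multiset.le_iff_exists_add.mp hsp
    have := congrArg Multiset.sum hu
    rw [p.parts_sum, Multiset.sum_add] at this
    omega

theorem finite_decTuple_le (r n : ℕ) : {m : DecTuple r | ∀ j, m.1 j ≤ n}.Finite :=
  (Set.finite_Iic (fun _ : Fin r => n)).preimage Subtype.val_injective.injOn

/-- A finite set that contains all pairs of size at most `n`. -/
noncomputable def box (r n : ℕ) : Finset (MultTuple r) :=
  (finite_decTuple_le r n).toFinset ×ˢ Fintype.piFinset fun _ => Finset.range n

theorem mem_box {r n : ℕ} (x : MultTuple r) :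
    x ∈ box r n ↔ (∀ j, x.1.1 j ≤ n) ∧ ∀ j, x.2 j < n := by
  simp [box]

theorem mem_box_of_size_le {r n : ℕ} (x : MultTuple r) (h : size x ≤ n) : x ∈ box r n := by
  rw [mem_box]
  have key : ∀ j, x.1.1 j * (x.2 j + 1) ≤ n := fun j =>
    (Finset.single_le_sum (f := fun j => x.1.1 j * (x.2 j + 1)) (fun _ _ => Nat.zero_le _)
      (Finset.mem_univ j)).trans h
  exact ⟨fun j => (Nat.le_mul_of_pos_right _ (Nat.succ_pos _)).trans (key j),
    fun j => (Nat.le_mul_of_pos_left _ (x.1.2.2 j)).trans (key j)⟩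

theorem Partition.le_of_mem_parts {n : ℕ} (p : n.Partition) {i : ℕ} (hi : i ∈ p.parts) : i ≤ n := by
  rw [← p.parts_sum]
  exact Multiset.le_sum_of_mem hi

theorem Partition.count_parts_le {n : ℕ} (p : n.Partition) (i : ℕ) : p.parts.count i ≤ n := by
  have := Multiset.card_nsmul_le_sum (s := p.parts) (a := 1) fun x hx => p.parts_pos hx
  rw [p.parts_sum, smul_eq_mul, mul_one] at this
  exact (Multiset.count_le_card _ _).trans this

/-- Each factor telescopes from the value `0` at `0`. In the expanded product, the condition `c_j <
r_{m_j}` for all `j` says exactly that the parts are contained in the partition. -/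
theorem P_eq_sum (F : ℕ → Polynomial ℚ) {r : ℕ} (k d : Fin r → ℕ)
    (hF : ∀ j, (F (k j)).eval 0 = 0) {n : ℕ} (p : n.Partition) :
    P F k d ⟨n, p⟩ = ∑ x ∈ box r n, if partsOf x ≤ p.parts then weight F k d x else 0 := by
  have hsupp : Function.support (PTerm F k d ⟨n, p⟩) ⊆ (finite_decTuple_le r n).toFinset := by
    intro m hm
    simp only [Set.Finite.coe_toFinset, Set.mem_ofPred_eq]
    intro j
    have h0 := Finset.prod_ne_zero_iff.mp hm j (Finset.mem_univ _)
    refine Partition.le_of_mem_parts p ?_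
    by_contra hmem
    apply h0
    have hz : mult (m.1 j) ⟨n, p⟩ = 0 := Multiset.count_eq_zero_of_notMem hmem
    rw [hz, Nat.cast_zero, hF, mul_zero]
  rw [P, finsum_eq_sum_of_support_subset _ hsupp, box, Finset.sum_product]
  refine Finset.sum_congr rfl fun m _ => ?_
  have hterm : PTerm F k d ⟨n, p⟩ m = ∏ j, ∑ c ∈ Finset.range (p.parts.count (m.1 j)),
      ((m.1 j : ℚ) ^ d j * ((F (k j)).eval ((c : ℚ) + 1) - (F (k j)).eval (c : ℚ))) := by
    refine Finset.prod_congr rfl fun j _ => ?_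
    rw [← Finset.mul_sum]
    have := Finset.sum_range_sub (fun c : ℕ => (F (k j)).eval (c : ℚ)) (p.parts.count (m.1 j))
    push_cast at this
    rw [this, hF, sub_zero]
    rfl
  rw [hterm, Finset.prod_univ_sum, ← Finset.sum_filter]
  refine Finset.sum_congr ?_ fun c _ => rfl
  ext c
  simp only [Fintype.mem_piFinset, Finset.mem_range, Finset.mem_filter, partsOf_le_iff]
  exact ⟨fun h => ⟨fun j => (h j).trans_le (Partition.count_parts_le p _), h⟩, fun h => h.2⟩

theorem sum_P_eq (F : ℕ → Polynomial ℚ) {r : ℕ} (k d : Fin r → ℕ)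
    (hF : ∀ j, (F (k j)).eval 0 = 0) (n : ℕ) :
    ∑ p : n.Partition, P F k d ⟨n, p⟩ = ∑ x ∈ box r n,
      if size x ≤ n then weight F k d x * Fintype.card (n - size x).Partition else 0 := by
  simp_rw [P_eq_sum F k d hF]
  rw [Finset.sum_comm]
  refine Finset.sum_congr rfl fun x _ => ?_
  rw [← Finset.sum_filter, Finset.sum_const, card_partitions_ge _ fun i => pos_of_mem_partsOf x,
    sum_partsOf, nsmul_eq_mul, mul_comm]
  split_ifs <;> simp

/-- The total weight of the pairs of size `n`. -/
noncomputable def weightSum (F : ℕ → Polynomial ℚ) {r : ℕ} (k d : Fin r → ℕ) (n : ℕ) : ℚ :=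
  ∑ x ∈ box r n, if size x = n then weight F k d x else 0

/-- One box can serve all coefficients up to `n`, so that the sums in the Cauchy product can be
exchanged. -/
theorem weightSum_eq_of_le (F : ℕ → Polynomial ℚ) {r : ℕ} (k d : Fin r → ℕ) {a n : ℕ}
    (h : a ≤ n) :
    weightSum F k d a = ∑ x ∈ box r n, if size x = a then weight F k d x else 0 := by
  refine Finset.sum_subset (fun x hx => ?_) fun x _ hx => ?_
  · rw [mem_box] at hx ⊢
    exact ⟨fun j => (hx.1 j).trans h, fun j => (hx.2 j).trans_le h⟩
  · exact if_neg fun hs => hx (mem_box_of_size_le x hs.le)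

theorem qBracket_P (F : ℕ → Polynomial ℚ) {r : ℕ} (k d : Fin r → ℕ)
    (hF : ∀ j, (F (k j)).eval 0 = 0) :
    qBracket (P F k d) = PowerSeries.mk (weightSum F k d) := by
  have hD : PowerSeries.constantCoeff
      (PowerSeries.mk (fun n => ∑ _p : n.Partition, (1 : ℚ))) ≠ 0 := by
    rw [← PowerSeries.coeff_zero_eq_constantCoeff_apply, PowerSeries.coeff_mk]
    simp
  symm
  rw [qBracket, PowerSeries.eq_mul_inv_iff_mul_eq hD]
  symm
  ext n
  rw [PowerSeries.coeff_mk, sum_P_eq F k d hF, PowerSeries.coeff_mul]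
  have : ∀ ab ∈ Finset.HasAntidiagonal.antidiagonal n,
      PowerSeries.coeff ab.1 (PowerSeries.mk (weightSum F k d)) *
        PowerSeries.coeff ab.2 (PowerSeries.mk (fun n => ∑ _p : n.Partition, (1 : ℚ))) =
      ∑ x ∈ box r n, if size x = ab.1 then
        weight F k d x * Fintype.card (n - size x).Partition else 0 := by
    rintro ⟨a, b⟩ hab
    have hab' : a + b = n := Finset.HasAntidiagonal.mem_antidiagonal.mp hab
    simp only [PowerSeries.coeff_mk]
    rw [weightSum_eq_of_le F k d (show a ≤ n by omega), Finset.sum_mul]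
    refine Finset.sum_congr rfl fun x _ => ?_
    split_ifs with hx
    · have hb : n - size x = b := by omega
      rw [hb]
      simp
    · simp
  rw [Finset.sum_congr rfl this, Finset.sum_comm]
  refine Finset.sum_congr rfl fun x _ => ?_
  rw [Finset.Nat.sum_antidiagonal_eq_sum_range_succ_mk]
  simp only [Finset.sum_ite_eq, Finset.mem_range, Nat.lt_succ_iff]

/-- The summand of the expansion of the `q`-bracket of `P` at a real number `q`. -/
noncomputable def expTerm {r : ℕ} (d : Fin r → ℕ) (b : Fin r → ℕ → ℝ) (q : ℝ)
    (x : MultTuple r) : ℝ :=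
  ∏ j, ((x.1.1 j : ℝ) ^ d j * (b j (x.2 j) * (q ^ x.1.1 j) ^ (x.2 j + 1)))

theorem expTerm_incr (F : ℕ → Polynomial ℚ) {r : ℕ} (k d : Fin r → ℕ) (q : ℝ) (x : MultTuple r) :
    expTerm d (fun j => incr (F (k j))) q x = weight F k d x * q ^ size x := by
  rw [expTerm, weight, size, ← Finset.prod_pow_eq_pow_sum, Rat.cast_prod, ← Finset.prod_mul_distrib]
  refine Finset.prod_congr rfl fun j _ => ?_
  rw [incr, pow_mul]
  push_cast
  ring

theorem summable_expTerm {r : ℕ} (d : Fin r → ℕ) (b : Fin r → ℕ → ℝ) {q : ℝ} (h0 : 0 < q)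
    (h1 : q < 1) (hb : ∀ j, Summable fun c => ‖b j c * q ^ (c + 1)‖) :
    Summable fun x => ‖expTerm d b q x‖ := by
  have hf : ∀ j : Fin r, Summable fun ac : ℕ × ℕ =>
      ‖(((ac.1 : ℝ) + 1) ^ d j * q ^ ac.1) * ‖b j ac.2 * q ^ (ac.2 + 1)‖‖ := by
    intro j
    have h := summable_powSum (d j) h0 h1
    have h' : Summable fun c : ℕ => ((c : ℝ) + 1) ^ d j * q ^ c := by
      refine (h.mul_left q⁻¹).congr fun c => ?_
      rw [pow_succ]; field_simp
    exact (h'.mul_of_nonneg (hb j) (fun c => by positivity) (fun c => norm_nonneg _)).norm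
  have hs := summable_pi_prod _ hf
  have hinj : Function.Injective fun (x : MultTuple r) (j : Fin r) => (x.1.1 j - 1, x.2 j) := by
    intro x y hxy
    have h2 : ∀ j, x.1.1 j - 1 = y.1.1 j - 1 ∧ x.2 j = y.2 j := fun j => by
      simpa using congrFun hxy j
    refine Prod.ext (Subtype.ext (funext fun j => ?_)) (funext fun j => (h2 j).2)
    have := (h2 j).1
    have := x.1.2.2 j
    have := y.1.2.2 j
    omega
  refine .of_nonneg_of_le (fun _ => norm_nonneg _) (fun x => ?_) (hs.comp_injective hinj)
  rw [expTerm, norm_prod]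
  refine Finset.prod_le_prod (fun _ _ => norm_nonneg _) fun j _ => ?_
  obtain ⟨a, ha⟩ : ∃ a, x.1.1 j = a + 1 := ⟨x.1.1 j - 1, by have := x.1.2.2 j; omega⟩
  simp only [ha, Nat.add_sub_cancel, norm_mul, norm_pow, Real.norm_of_nonneg h0.le]
  rw [← Nat.cast_succ, Nat.succ_eq_add_one, Real.norm_natCast, ← pow_mul, mul_assoc,
     mul_left_comm (q ^ a), ← pow_add]
  -- The inequality `(a + 1)(c + 1) ≥ a + (c + 1)` separates the variables; this crude bound
  -- suffices at fixed `q`.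
  have : q ^ ((a + 1) * (x.2 j + 1)) ≤ q ^ (a + (x.2 j + 1)) :=
    pow_le_pow_of_le_one h0.le h1.le (by nlinarith [Nat.zero_le (a * x.2 j)])
  gcongr

theorem hasSum_qBracketTerm_P (F : ℕ → Polynomial ℚ) {r : ℕ} (k d : Fin r → ℕ)
    (hF : ∀ j, (F (k j)).eval 0 = 0) {q : ℝ} (h0 : 0 < q) (h1 : q < 1) :
    HasSum (qBracketTerm (P F k d) q)
      (∑' x : MultTuple r, expTerm d (fun j => incr (F (k j))) q x) := by
  have hs := (summable_expTerm d (fun j => incr (F (k j))) h0 h1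
    fun j => summable_norm_incr _ h0 h1).of_norm
  -- Absolute convergence allows grouping the pairs by size; each fibre is supported in a finite
  -- box.
  have h := ((Equiv.sigmaFiberEquiv (size (r := r))).hasSum_iff).mpr hs.hasSum
  have h2 := h.sigma (g := qBracketTerm (P F k d) q) ?_
  · exact h2
  · intro n
    rw [qBracketTerm, qBracket_P F k d hF, PowerSeries.coeff_mk, weightSum, Rat.cast_sum,
      Finset.sum_mul]
    refine (hasSum_subtype_iff_indicator (s := {x | size x = n})
      (f := expTerm d (fun j => incr (F (k j))) q)).mpr ?_
    have h3 : HasSum ({x | size x = n}.indicator (expTerm d (fun j => incr (F (k j))) q))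
        (∑ x ∈ box r n, {x | size x = n}.indicator (expTerm d (fun j => incr (F (k j))) q) x) :=
      hasSum_sum_of_ne_finset_zero fun x hx =>
        Set.indicator_of_notMem (s := {x | size x = n})
          (fun hs => hx (mem_box_of_size_le x (le_of_eq hs))) _
    convert h3 using 1
    refine Finset.sum_congr rfl fun x _ => ?_
    by_cases hx : size x = n
    · rw [Set.indicator_of_mem (by exact hx), if_pos hx, expTerm_incr, hx]
    · rw [Set.indicator_of_notMem (by exact hx), if_neg hx, Rat.cast_zero, zero_mul]

/-! ### Gap coordinates and conjugation -/

/-- The sums `(u_j + 1) + ⋯ + (u_t + 1)`. -/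
def tailSum {t : ℕ} (u : Fin t → ℕ) (j : Fin t) : ℕ := ∑ i ∈ Finset.Ici j, (u i + 1)

theorem strictAnti_tailSum {t : ℕ} (u : Fin t → ℕ) : StrictAnti (tailSum u) := by
  intro i j hij
  refine Finset.sum_lt_sum_of_subset (i := i) (Finset.Ici_subset_Ici.mpr hij.le) (by simp)
    (by simpa using hij) (Nat.succ_pos _) fun _ _ _ => Nat.zero_le _

theorem tailSum_pos {t : ℕ} (u : Fin t → ℕ) (j : Fin t) : 0 < tailSum u j :=
  Finset.sum_pos (fun _ _ => Nat.succ_pos _) ⟨j, by simp⟩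

theorem tailSum_eq_add {t : ℕ} (u : Fin t → ℕ) (j : Fin t) :
    tailSum u j = u j + 1 + if h : (j : ℕ) + 1 < t then tailSum u ⟨j + 1, h⟩ else 0 := by
  rw [tailSum, ← Finset.Ioi_insert, Finset.sum_insert (by simp)]
  congr 1
  split_ifs with h
  · refine Finset.sum_congr ?_ fun _ _ => rfl
    ext i
    simp only [Finset.mem_Ioi, Finset.mem_Ici, Fin.lt_def, Fin.le_def]
    omega
  · refine Finset.sum_eq_zero fun i hi => absurd i.2 ?_
    have := Fin.lt_def.mp (Finset.mem_Ioi.mp hi)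
    omega

theorem tailSum_injective {t : ℕ} : Function.Injective (tailSum (t := t)) := by
  intro u v huv
  funext j
  have h := congrFun huv j
  rw [tailSum_eq_add u, tailSum_eq_add v, huv] at h
  omega

theorem exists_eq_add_tailSum {t : ℕ} (m : Fin t → ℕ) (hm : StrictAnti m) (M : ℕ)
    (hM : ∀ j, M < m j) : ∃ u : Fin t → ℕ, ∀ j, m j = M + tailSum u j := by
  -- Continuing the tuple by `M` past its end makes the last gap the distance to `M`; the `- 1`
  -- below reflects that gaps are `u_j + 1`.
  let e : ℕ → ℕ := fun i => if h : i < t then m ⟨i, h⟩ else M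
  refine ⟨fun j => m j - e (j + 1) - 1, ?_⟩
  have key : ∀ n : ℕ, ∀ j : Fin t, (j : ℕ) + n + 1 = t →
      m j = M + tailSum (fun j => m j - e (j + 1) - 1) j := by
    intro n
    induction n with
    | zero =>
      intro j hj
      have h1 : ¬ (j : ℕ) + 1 < t := by omega
      have := hM j
      rw [tailSum_eq_add, dif_neg h1]
      simp only [e, dif_neg h1]
      omega
    | succ n ih =>
      intro j hj
      have h1 : (j : ℕ) + 1 < t := by omega
      have h2 : m ⟨j + 1, h1⟩ < m j := hm (by simp [Fin.lt_def])
      have h3 := ih ⟨j + 1, h1⟩ (by simp; omega)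
      rw [tailSum_eq_add, dif_pos h1]
      simp only [e, dif_pos h1] at h3 ⊢
      omega
  intro j
  exact key (t - 1 - j) j (by omega)

/-- The decreasing tuple with entries `M + (u_j + 1) + ⋯ + (u_t + 1)`. -/
def shiftTuple {t : ℕ} (M : ℕ) (u : Fin t → ℕ) : DecTuple t :=
  ⟨fun j => M + tailSum u j, fun _ _ h => Nat.add_lt_add_left (strictAnti_tailSum u h) M,
    fun j => Nat.add_pos_right _ (tailSum_pos u j)⟩

theorem shiftTuple_injective {t : ℕ} (M : ℕ) : Function.Injective (shiftTuple (t := t) M) := by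
  intro u v h
  refine tailSum_injective (funext fun j => ?_)
  have := congrFun (congrArg Subtype.val h) j
  exact Nat.add_left_cancel this

/-- The largest entry of a decreasing tuple, `0` for the empty tuple. -/
def top {s : ℕ} (m : DecTuple s) : ℕ := if h : 0 < s then m.1 ⟨0, h⟩ else 0

theorem le_top {s : ℕ} (m : DecTuple s) (j : Fin s) : m.1 j ≤ top m := by
  have hs : 0 < s := (Nat.zero_le _).trans_lt j.2
  rw [top, dif_pos hs]
  exact m.2.1.antitone (Fin.mk_le_of_le_val (Nat.zero_le _))

/-- The decreasing tuple obtained by putting larger entries, with gaps `u_j + 1`, before `m`. -/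
def extend {s t : ℕ} (m : DecTuple s) (u : Fin t → ℕ) : DecTuple (t + s) :=
  ⟨Fin.append (shiftTuple (top m) u).1 m.1, by
    intro i j
    refine Fin.addCases (fun i => ?_) (fun i => ?_) i <;>
      refine Fin.addCases (fun j => ?_) (fun j => ?_) j <;> intro h
    · simp only [Fin.append_left]
      exact (shiftTuple (top m) u).2.1 (Fin.lt_def.mpr (Fin.lt_def.mp h))
    · simp only [Fin.append_left, Fin.append_right]
      exact (le_top m j).trans_lt (Nat.lt_add_of_pos_right (tailSum_pos u i))
    · have := Fin.lt_def.mp h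
      simp only [Fin.val_natAdd, Fin.val_castAdd] at this
      omega
    · simp only [Fin.append_right]
      exact m.2.1 (by simpa using h), by
    intro i
    refine Fin.addCases (fun i => ?_) (fun i => ?_) i
    · rw [Fin.append_left]; exact (shiftTuple (top m) u).2.2 i
    · rw [Fin.append_right]; exact m.2.2 i⟩

/-- A decreasing tuple is determined by its last `s` entries and the positive gaps above them. For
`s = 0` the gaps are measured from `top = 0`. -/
theorem extend_bijective {s t : ℕ} :
    Function.Bijective fun x : DecTuple s × (Fin t → ℕ) => extend x.1 x.2 := by
  constructor
  · rintro ⟨m, u⟩ ⟨m', u'⟩ h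
    have h1 : ∀ i, Fin.append (shiftTuple (top m) u).1 m.1 i =
        Fin.append (shiftTuple (top m') u').1 m'.1 i := congrFun (congrArg Subtype.val h)
    obtain rfl : m = m' := Subtype.ext (funext fun j => by
      simpa only [Fin.append_right] using h1 (Fin.natAdd t j))
    obtain rfl : u = u' := shiftTuple_injective (top m) (Subtype.ext (funext fun j => by
      simpa only [Fin.append_left] using h1 (Fin.castAdd s j)))
    rfl
  · intro m
    let m' : DecTuple s := ⟨fun j => m.1 (Fin.natAdd t j),
      fun i j h => m.2.1 (by simpa using h), fun j => m.2.2 _⟩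
    obtain ⟨u, hu⟩ := exists_eq_add_tailSum (fun j => m.1 (Fin.castAdd s j))
      (fun i j h => m.2.1 (Fin.lt_def.mpr (Fin.lt_def.mp h))) (top m') (by
        intro j
        rw [top]
        split_ifs with hs
        · exact m.2.1 (by simp [Fin.lt_def])
        · exact m.2.2 _)
    refine ⟨(m', u), Subtype.ext (funext fun i => ?_)⟩
    refine Fin.addCases (fun i => ?_) (fun i => ?_) i
    · simp only [extend, Fin.append_left]
      exact (hu i).symm
    · simp only [extend, Fin.append_right]
      rfl

/-- The sums `(c_1 + 1) + ⋯ + (c_i + 1)`. -/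
def initSum {t : ℕ} (c : Fin t → ℕ) (i : Fin t) : ℕ := ∑ j ∈ Finset.Iic i, (c j + 1)

theorem initSum_eq_tailSum_rev {t : ℕ} (c : Fin t → ℕ) (i : Fin t) :
    initSum c i = tailSum (c ∘ Fin.rev) i.rev := by
  refine Finset.sum_equiv Fin.revPerm (fun j => ?_) fun j _ => ?_
  · simp [Fin.rev_le_rev]
  · simp

theorem initSum_pos {t : ℕ} (c : Fin t → ℕ) (j : Fin t) : 0 < initSum c j := by
  rw [initSum_eq_tailSum_rev]; exact tailSum_pos _ _

theorem strictMono_initSum {t : ℕ} (c : Fin t → ℕ) : StrictMono (initSum c) := by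
  intro i j h
  rw [initSum_eq_tailSum_rev, initSum_eq_tailSum_rev]
  exact strictAnti_tailSum _ (Fin.rev_lt_rev.mpr h)

/-- The increasing tuple with gaps `c_j + 1`. -/
def incTuple {t : ℕ} (c : Fin t → ℕ) : IncTuple t :=
  ⟨initSum c, strictMono_initSum c, initSum_pos c⟩

theorem incTuple_bijective {t : ℕ} : Function.Bijective (incTuple (t := t)) := by
  constructor
  · intro c c' h
    have h1 : ∀ i, initSum c i = initSum c' i := congrFun (congrArg Subtype.val h)
    have h2 : c ∘ Fin.rev = c' ∘ Fin.rev := tailSum_injective (funext fun i => by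
      have := h1 i.rev
      rwa [initSum_eq_tailSum_rev, initSum_eq_tailSum_rev, Fin.rev_rev] at this)
    funext i
    simpa using congrFun h2 i.rev
  · intro m
    obtain ⟨u, hu⟩ := exists_eq_add_tailSum (fun j => m.1 j.rev)
      (fun i j h => m.2.1 (Fin.rev_lt_rev.mpr h)) 0 fun j => m.2.2 _
    refine ⟨u ∘ Fin.rev, Subtype.ext (funext fun i => ?_)⟩
    have h := hu i.rev
    rw [Fin.rev_rev, zero_add] at h
    rw [h]
    change initSum _ i = _
    rw [initSum_eq_tailSum_rev]
    congr 1
    funext j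
    simp

/-- Both sides are the sum of `(u_i + 1)(c_j + 1)` over `j ≤ i`: the size of a partition computed
from its diagram and from the conjugate one. -/
theorem sum_tailSum_mul {t : ℕ} (u c : Fin t → ℕ) :
    ∑ j, tailSum u j * (c j + 1) = ∑ i, initSum c i * (u i + 1) := by
  simp_rw [tailSum, initSum, Finset.sum_mul]
  rw [Finset.sum_comm' (t' := Finset.univ) (s' := fun i => Finset.Iic i) (by simp)]
  exact Finset.sum_congr rfl fun i _ => Finset.sum_congr rfl fun j _ => mul_comm _ _

/-! ### Separating the entries with `k = 1` -/

/-- The factors of the expansion that come from the entries with `k = 1`. -/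
noncomputable def headTerm {t : ℕ} (d : Fin t → ℕ) (q : ℝ) (M : ℕ)
    (uc : (Fin t → ℕ) × (Fin t → ℕ)) : ℝ :=
  ∏ j, (((M + tailSum uc.1 j : ℕ) : ℝ) ^ d j * (q ^ (M + tailSum uc.1 j)) ^ (uc.2 j + 1))

theorem headTerm_nonneg {t : ℕ} (d : Fin t → ℕ) {q : ℝ} (h0 : 0 < q) (M : ℕ)
    (uc : (Fin t → ℕ) × (Fin t → ℕ)) : 0 ≤ headTerm d q M uc :=
  Finset.prod_nonneg fun _ _ => by positivity

theorem summable_headTerm {t : ℕ} (d : Fin t → ℕ) {q : ℝ} (h0 : 0 < q) (h1 : q < 1) (M : ℕ) :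
    Summable (headTerm d q M) := by
  have h := (summable_expTerm d (fun _ _ => 1) h0 h1 fun _ => by
    have := summable_powSum 0 h0 h1
    simpa using this.norm).of_norm
  have hinj : Function.Injective fun uc : (Fin t → ℕ) × (Fin t → ℕ) =>
      ((shiftTuple M uc.1, uc.2) : MultTuple t) :=
    (shiftTuple_injective M).prodMap Function.injective_id
  refine (h.comp_injective hinj).congr fun uc => ?_
  simp [expTerm, headTerm, shiftTuple]

/-- Tuples with all entries above `M` form a subfamily of all tuples of positive entries, and the
terms are nonnegative. -/
theorem tsum_headTerm_le {t : ℕ} (d : Fin t → ℕ) {q : ℝ} (h0 : 0 < q) (h1 : q < 1) (M : ℕ) :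
    ∑' uc, headTerm d q M uc ≤ ∑' uc, headTerm d q 0 uc := by
  have h : ∀ u : Fin t → ℕ, ∃ v : Fin t → ℕ, ∀ j, M + tailSum u j = 0 + tailSum v j := fun u =>
    exists_eq_add_tailSum _ (shiftTuple M u).2.1 0 (shiftTuple M u).2.2
  choose v hv using h
  have hinj : Function.Injective v := fun u u' huu => shiftTuple_injective M <| Subtype.ext <|
    funext fun j => by
      change M + tailSum u j = M + tailSum u' j
      rw [hv, hv, huu]
  have := tsum_comp_le_tsum_of_inj (summable_headTerm d h0 h1 0) (headTerm_nonneg d h0 0)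
    (hinj.prodMap (Function.injective_id (α := Fin t → ℕ)))
  refine le_trans (le_of_eq (tsum_congr fun uc => ?_)) this
  simp only [headTerm, Function.comp, Prod.map, hv, id]

/-- The powers of `q` agree exactly; only the factors with exponent `d j` grow under the shift by
`M`. Together with `tsum_headTerm_le` this prepares a squeeze. -/
theorem headTerm_zero_le {t : ℕ} (d : Fin t → ℕ) {q : ℝ} (h0 : 0 < q) (M : ℕ)
    (uc : (Fin t → ℕ) × (Fin t → ℕ)) :
    (∏ j, (q ^ M) ^ (uc.2 j + 1)) * headTerm d q 0 uc ≤ headTerm d q M uc := by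
  rw [headTerm, headTerm, ← Finset.prod_mul_distrib]
  refine Finset.prod_le_prod (fun _ _ => by positivity) fun j _ => ?_
  rw [mul_left_comm, ← mul_pow, ← pow_add, zero_add]
  gcongr
  omega

theorem incr_X (c : ℕ) : incr Polynomial.X c = 1 := by simp [incr]

theorem WellNormalized.apply_one {F : ℕ → Polynomial ℚ} (hF : WellNormalized F) :
    F 1 = Polynomial.X := by
  have h0 := hF.eval_zero 1 le_rfl
  have h1 := hF.leadingCoeff_eq 1
  rw [Polynomial.leadingCoeff, hF.natDegree_eq] at h1
  rw [← Polynomial.coeff_zero_eq_eval_zero] at h0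
  rw [Polynomial.eq_X_add_C_of_natDegree_le_one (hF.natDegree_eq 1).le, h0, h1]
  simp

theorem expTerm_extend {F : ℕ → Polynomial ℚ} (hF : WellNormalized F) {t s : ℕ} (d : Fin t → ℕ)
    (k : Fin s → ℕ) (q : ℝ) (m : DecTuple s) (u c : Fin t → ℕ) (c' : Fin s → ℕ) :
    expTerm (Fin.append d (fun _ : Fin s => 0))
      (fun j => incr (F (Fin.append (fun _ : Fin t => 1) k j))) q
      (extend m u, Fin.append c c') =
    (∏ j, incr (F (k j)) (c' j) * (q ^ m.1 j) ^ (c' j + 1)) * headTerm d q (top m) (u, c) := by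
  rw [expTerm, Fin.prod_univ_add, mul_comm]
  simp only [extend, Fin.append_left, Fin.append_right, pow_zero, one_mul, hF.apply_one, incr_X]
  rfl

/-- The reindexing of the expansion by the last entries, their multiplicities, and the gaps and
multiplicities of the first entries. -/
noncomputable def splitEquiv (t s : ℕ) :
    DecTuple s × ((Fin s → ℕ) × ((Fin t → ℕ) × (Fin t → ℕ))) ≃ MultTuple (t + s) :=
  (show DecTuple s × ((Fin s → ℕ) × ((Fin t → ℕ) × (Fin t → ℕ))) ≃
      (DecTuple s × (Fin t → ℕ)) × ((Fin t → ℕ) × (Fin s → ℕ)) from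
    { toFun := fun x => ((x.1, x.2.2.1), (x.2.2.2, x.2.1))
      invFun := fun y => (y.1.1, (y.2.2, (y.1.2, y.2.1)))
      left_inv := fun _ => rfl
      right_inv := fun _ => rfl }).trans
    ((Equiv.ofBijective _ extend_bijective).prodCongr (Fin.appendEquiv t s))

/-- The first block depends on the second only through the largest entry of the latter, so for fixed
`m` the sums over the two blocks factor. -/
theorem tsum_expTerm {F : ℕ → Polynomial ℚ} (hF : WellNormalized F) {t s : ℕ} (d : Fin t → ℕ)
    (k : Fin s → ℕ) {q : ℝ} (h0 : 0 < q) (h1 : q < 1) :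
    ∑' x, expTerm (Fin.append d (fun _ : Fin s => 0))
      (fun j => incr (F (Fin.append (fun _ : Fin t => 1) k j))) q x =
    ∑' m : DecTuple s, (∏ j, incrSum (F (k j)) (q ^ m.1 j)) * ∑' uc, headTerm d q (top m) uc := by
  have hs := (summable_expTerm (Fin.append d (fun _ : Fin s => 0))
    (fun j => incr (F (Fin.append (fun _ : Fin t => 1) k j))) h0 h1
    fun j => summable_norm_incr _ h0 h1).of_norm
  rw [← (splitEquiv t s).tsum_eq]
  refine ((splitEquiv t s).summable_iff.mpr hs).tsum_prod.trans ?_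
  refine tsum_congr fun m => ?_
  have hq : ∀ j, Summable fun c => ‖incr (F (k j)) c * (q ^ m.1 j) ^ (c + 1)‖ := fun j =>
    summable_norm_incr _ (by positivity) (pow_lt_one₀ h0.le h1 (m.2.2 j).ne')
  obtain ⟨hn, he⟩ := summable_and_tsum_pi_prod
    (fun (j : Fin s) c => incr (F (k j)) c * (q ^ m.1 j) ^ (c + 1)) hq
  simp only [incrSum]
  rw [← he, tsum_mul_tsum_of_summable_norm hn (summable_headTerm d h0 h1 _).norm]
  exact tsum_congr fun x => expTerm_extend hF d k q m x.2.1 x.2.2 x.1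

/-! ### The limiting series, `headPoly` and `Omega` -/

/-- Applied with `i₀` the position of the largest index, this reduces convergence to
`summable_prod_one_div_mul`. -/
theorem prod_one_div_pow_le {r : ℕ} {m : Fin r → ℕ} (hm : ∀ i, 0 < m i) (e : Fin r → ℕ)
    (i₀ : Fin r) (he : 1 ≤ e i₀) :
    ∏ i, 1 / (m i : ℝ) ^ (e i + 1) ≤ (∏ i, 1 / (m i : ℝ)) * (1 / (m i₀ : ℝ)) := by
  have h1 : ∀ i, 1 / (m i : ℝ) ≤ 1 := fun i => by
    have : (1 : ℝ) ≤ m i := by exact_mod_cast hm i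
    rw [div_le_one (by linarith)]
    exact this
  have h2 : ∏ i, (1 / (m i : ℝ)) ^ e i ≤ ∏ i, if i = i₀ then 1 / (m i : ℝ) else 1 := by
    refine Finset.prod_le_prod (fun _ _ => by positivity) fun i _ => ?_
    split_ifs with h
    · subst h
      simpa using pow_le_pow_of_le_one (by positivity) (h1 i) he
    · exact pow_le_one₀ (by positivity) (h1 i)
  rw [Finset.prod_ite_eq' Finset.univ i₀, if_pos (Finset.mem_univ _)] at h2
  calc ∏ i, 1 / (m i : ℝ) ^ (e i + 1) = (∏ i, 1 / (m i : ℝ)) * ∏ i, (1 / (m i : ℝ)) ^ e i := by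
        rw [← Finset.prod_mul_distrib]
        exact Finset.prod_congr rfl fun i _ => by rw [← one_div_pow, pow_succ']
    _ ≤ _ := by gcongr

theorem zetaTerm_pos {s : ℕ} (k : Fin s → ℕ) (m : DecTuple s) : 0 < zetaTerm k m :=
  Finset.prod_pos fun i _ => by
    have : 0 < m.1 i := m.2.2 i
    positivity

theorem summable_zetaTerm {s : ℕ} (k : Fin s → ℕ) (hk : ∀ i, 1 ≤ k i)
    (hk_first : ∀ i : Fin s, (i : ℕ) = 0 → 2 ≤ k i) : Summable (zetaTerm k) := by
  rcases Nat.eq_zero_or_pos s with rfl | hs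
  · have : Finite (DecTuple 0) := inferInstance
    exact (hasSum_fintype _).summable
  · refine .of_nonneg_of_le (fun m => (zetaTerm_pos k m).le) (fun m => ?_)
      (summable_prod_one_div_mul hs (fun m : DecTuple s => m.1) Subtype.val_injective
        (fun m => m.2.2) (fun m => m.1 ⟨0, hs⟩)
        fun m i => m.2.1.antitone (Fin.mk_le_of_le_val (Nat.zero_le _)))
    have h := prod_one_div_pow_le m.2.2 (fun i => k i - 1) ⟨0, hs⟩
      (Nat.le_sub_one_of_lt (hk_first _ rfl))
    refine le_trans (le_of_eq (Finset.prod_congr rfl fun i _ => ?_)) h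
    rw [Nat.sub_add_cancel (hk i)]

/-- The polynomial `∏ (X_i + ⋯ + X_t)^{d_i}`. -/
noncomputable def headPoly {t : ℕ} (d : Fin t → ℕ) : MvPolynomial (Fin t) ℚ :=
  ∏ i, (∑ j ∈ Finset.Ici i, (MvPolynomial.X j : MvPolynomial (Fin t) ℚ)) ^ d i

theorem coeff_headPoly_nonneg {t : ℕ} (d : Fin t → ℕ) (l : Fin t →₀ ℕ) :
    0 ≤ (headPoly d).coeff l := by
  have : headPoly d = MvPolynomial.map (Nat.castRingHom ℚ)
      (∏ i, (∑ j ∈ Finset.Ici i, (MvPolynomial.X j : MvPolynomial (Fin t) ℕ)) ^ d i) := by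
    simp [headPoly]
  rw [this, MvPolynomial.coeff_map]
  exact Nat.cast_nonneg _

theorem aeval_eq_sum {t : ℕ} (p : MvPolynomial (Fin t) ℚ) (x : Fin t → ℝ) :
    MvPolynomial.aeval x p = ∑ l ∈ p.support, ((p.coeff l : ℚ) : ℝ) * ∏ i, x i ^ l i := by
  rw [MvPolynomial.aeval_def, MvPolynomial.eval₂_eq']
  rfl

/-- Homogeneity: all monomials are normalized by the same power of `1 - q`. -/
theorem sum_of_mem_support_headPoly {t : ℕ} (d : Fin t → ℕ) {l : Fin t →₀ ℕ}
    (hl : l ∈ (headPoly d).support) : ∑ i, l i = ∑ i, d i := by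
  have h : (headPoly d).IsHomogeneous (∑ i, 1 * d i) :=
    MvPolynomial.IsHomogeneous.prod _ _ _ fun i _ =>
      (MvPolynomial.IsHomogeneous.sum _ _ _ fun j _ => MvPolynomial.isHomogeneous_X _ _).pow _
  have := h (MvPolynomial.mem_support_iff.mp hl)
  rw [Pi.one_def, ← Finsupp.degree_eq_weight_one] at this
  simpa [Finsupp.degree_eq_sum] using this

theorem headPoly_ne_zero {t : ℕ} (d : Fin t → ℕ) : headPoly d ≠ 0 := by
  intro h
  have h1 := congrArg (MvPolynomial.aeval fun _ => (1 : ℝ)) h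
  simp only [headPoly, map_prod, map_pow, map_sum, MvPolynomial.aeval_X, map_zero] at h1
  rw [Finset.prod_eq_zero_iff] at h1
  obtain ⟨i, -, hi⟩ := h1
  have h2 := eq_zero_of_pow_eq_zero hi
  have h3 : (0 : ℝ) < ∑ j ∈ Finset.Ici i, 1 := Finset.sum_pos (fun _ _ => one_pos) ⟨i, by simp⟩
  exact h3.ne' h2

/-- The last factor is a pure power of the last variable, which therefore divides `headPoly`. This
supplies the extra power needed for the convergence of `xi`. -/
theorem one_le_of_mem_support_headPoly {t : ℕ} (d : Fin t → ℕ) (i : Fin t) (hi : (i : ℕ) + 1 = t)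
    (hd : 1 ≤ d i) {l : Fin t →₀ ℕ} (hl : l ∈ (headPoly d).support) : 1 ≤ l i := by
  have hIci : Finset.Ici i = {i} := by
    ext j
    simp only [Finset.mem_Ici, Finset.mem_singleton, Fin.le_def, Fin.ext_iff]
    omega
  have h1 : (MvPolynomial.X i : MvPolynomial (Fin t) ℚ) ∣ headPoly d := by
    refine dvd_trans ?_ (Finset.dvd_prod_of_mem _ (Finset.mem_univ i))
    rw [hIci, Finset.sum_singleton]
    exact dvd_pow_self _ (by omega)
  obtain ⟨p, hp⟩ := h1
  rw [MvPolynomial.mem_support_iff, hp, MvPolynomial.coeff_X_mul'] at hl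
  by_contra h
  apply hl
  rw [if_neg]
  simp only [Finsupp.mem_support_iff]
  omega

theorem Omega_eq_sum {t : ℕ} (p : MvPolynomial (Fin t) ℚ) :
    Omega t p = ∑ l ∈ p.support,
      MvPolynomial.monomial l (p.coeff l * ∏ i, (Nat.factorial (l i) : ℚ)) := by
  conv_lhs => rw [p.as_sum, map_sum]
  refine Finset.sum_congr rfl fun l _ => ?_
  have h1 : (MvPolynomial.monomial l (p.coeff l) : MvPolynomial (Fin t) ℚ) =
      p.coeff l • MvPolynomial.basisMonomials (Fin t) ℚ l := by
    rw [MvPolynomial.coe_basisMonomials, MvPolynomial.smul_monomial, smul_eq_mul, mul_one]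
  rw [h1, map_smul, Omega, Module.Basis.constr_basis, MvPolynomial.smul_monomial, smul_eq_mul]

theorem xiTerm_eq_sum {t : ℕ} (d : Fin t → ℕ) (m : IncTuple t) :
    xiTerm d m = ∑ l ∈ (headPoly d).support, (((headPoly d).coeff l : ℚ) : ℝ) *
      ∏ i, ((l i).factorial * (1 / (m.1 i : ℝ) ^ (l i + 1))) := by
  have h : xiTerm d m = (∏ i, 1 / (m.1 i : ℝ)) *
    MvPolynomial.aeval (fun i => 1 / (m.1 i : ℝ)) (Omega t (headPoly d)) := rfl
  rw [h, Omega_eq_sum, map_sum, Finset.mul_sum]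
  refine Finset.sum_congr rfl fun l _ => ?_
  rw [MvPolynomial.aeval_monomial, Finsupp.prod_fintype _ _ (by simp)]
  have : ∏ i, (((l i).factorial : ℝ) * (1 / (m.1 i : ℝ) ^ (l i + 1))) =
      (∏ i, ((l i).factorial : ℝ)) * ((∏ i, 1 / (m.1 i : ℝ)) * ∏ i, (1 / (m.1 i : ℝ)) ^ l i) := by
    rw [← Finset.prod_mul_distrib, ← Finset.prod_mul_distrib]
    exact Finset.prod_congr rfl fun i _ => by rw [← one_div_pow, pow_succ']
  rw [this, eq_ratCast]
  push_cast
  ring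

theorem xiTerm_pos {t : ℕ} (d : Fin t → ℕ) (m : IncTuple t) : 0 < xiTerm d m := by
  rw [xiTerm_eq_sum]
  refine Finset.sum_pos (fun l hl => ?_) (MvPolynomial.support_nonempty.mpr (headPoly_ne_zero d))
  have h1 : (0 : ℝ) < (((headPoly d).coeff l : ℚ) : ℝ) := by
    exact_mod_cast (coeff_headPoly_nonneg d l).lt_of_ne' (MvPolynomial.mem_support_iff.mp hl)
  refine mul_pos h1 (Finset.prod_pos fun i _ => ?_)
  have : 0 < m.1 i := m.2.2 i
  positivity

/-! ### Asymptotics of the entries with `k = 1` -/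

/-- Tail sums are linear forms in `u_i + 1`, so their powers expand through `headPoly`; conjugation
rewrites the power of `q`. Each resulting term is a product over `i` of functions of `u i` alone. -/
theorem headTerm_zero_eq {t : ℕ} (d : Fin t → ℕ) (q : ℝ) (u c : Fin t → ℕ) :
    headTerm d q 0 (u, c) = ∑ l ∈ (headPoly d).support, (((headPoly d).coeff l : ℚ) : ℝ) *
      ∏ i, (((u i : ℝ) + 1) ^ l i * (q ^ initSum c i) ^ (u i + 1)) := by
  have h1 := aeval_eq_sum (headPoly d) fun i => (u i : ℝ) + 1
  simp only [headPoly, map_prod, map_pow, map_sum, MvPolynomial.aeval_X] at h1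
  simp only [← headPoly.eq_1] at h1
  have h2 : ∏ j, (q ^ tailSum u j) ^ (c j + 1) = ∏ i, (q ^ initSum c i) ^ (u i + 1) := by
    simp_rw [← pow_mul, Finset.prod_pow_eq_pow_sum, sum_tailSum_mul]
  have h3 : headTerm d q 0 (u, c) = (∏ i, (∑ j ∈ Finset.Ici i, ((u j : ℝ) + 1)) ^ d i) *
      ∏ j, (q ^ tailSum u j) ^ (c j + 1) := by
    rw [← Finset.prod_mul_distrib]
    refine Finset.prod_congr rfl fun j _ => ?_
    simp [tailSum]
  rw [h3, h1, h2, Finset.sum_mul]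
  refine Finset.sum_congr rfl fun l _ => ?_
  rw [Finset.prod_mul_distrib, mul_assoc]

theorem tsum_headTerm_zero {t : ℕ} (d : Fin t → ℕ) {q : ℝ} (h0 : 0 < q) (h1 : q < 1)
    (c : Fin t → ℕ) :
    ∑' u, headTerm d q 0 (u, c) = ∑ l ∈ (headPoly d).support, (((headPoly d).coeff l : ℚ) : ℝ) *
      ∏ i, powSum (l i) (q ^ initSum c i) := by
  have hs : ∀ (l : Fin t →₀ ℕ) (i : Fin t),
      Summable fun a : ℕ => ‖((a : ℝ) + 1) ^ l i * (q ^ initSum c i) ^ (a + 1)‖ := fun l i =>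
    (summable_powSum _ (by positivity) (pow_lt_one₀ h0.le h1 (initSum_pos c i).ne')).norm
  simp_rw [headTerm_zero_eq]
  rw [Summable.tsum_finsetSum fun l _ => (summable_pi_prod _ (hs l)).mul_left _]
  refine Finset.sum_congr rfl fun l _ => ?_
  rw [tsum_mul_left, (summable_and_tsum_pi_prod _ (hs l)).2]
  rfl

theorem one_sub_pow_mul_tsum_headTerm_zero {t : ℕ} (d : Fin t → ℕ) {q : ℝ} (h0 : 0 < q)
    (h1 : q < 1) (c : Fin t → ℕ) :
    (1 - q) ^ (∑ i, (d i + 1)) * ∑' u, headTerm d q 0 (u, c) =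
      ∑ l ∈ (headPoly d).support, (((headPoly d).coeff l : ℚ) : ℝ) *
        ∏ i, ((1 - q) ^ (l i + 1) * powSum (l i) (q ^ initSum c i)) := by
  rw [tsum_headTerm_zero d h0 h1, Finset.mul_sum]
  refine Finset.sum_congr rfl fun l hl => ?_
  rw [Finset.prod_mul_distrib, Finset.prod_pow_eq_pow_sum, Finset.sum_add_distrib,
    Finset.sum_add_distrib, sum_of_mem_support_headPoly d hl]
  ring

/-- A majorant, uniform in `q`, of the normalized sums over `u`. -/
noncomputable def headBound {t : ℕ} (d : Fin t → ℕ) (c : Fin t → ℕ) : ℝ :=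
  ∑ l ∈ (headPoly d).support, (((headPoly d).coeff l : ℚ) : ℝ) *
    ∏ i, (((l i).factorial * ((l i + 1 : ℕ) : ℝ) ^ (l i + 1)) *
      (1 / (initSum c i : ℝ) ^ (l i + 1)))

theorem le_headBound {t : ℕ} (d : Fin t → ℕ) {q : ℝ} (h0 : 0 < q) (h1 : q < 1)
    (c : Fin t → ℕ) :
    (1 - q) ^ (∑ i, (d i + 1)) * ∑' u, headTerm d q 0 (u, c) ≤ headBound d c := by
  rw [one_sub_pow_mul_tsum_headTerm_zero d h0 h1]
  have hq : 0 ≤ 1 - q := by linarith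
  refine Finset.sum_le_sum fun l _ => mul_le_mul_of_nonneg_left
    (Finset.prod_le_prod (fun i _ => ?_) fun i _ => ?_)
    (by exact_mod_cast coeff_headPoly_nonneg d l)
  · exact mul_nonneg (pow_nonneg hq _) (powSum_nonneg _ (by positivity))
  · exact one_sub_pow_mul_powSum_le _ (initSum_pos c i) h0 h1

theorem summable_headBound {t : ℕ} (d : Fin t → ℕ)
    (hd : ∀ i : Fin t, (i : ℕ) + 1 = t → 1 ≤ d i) : Summable (headBound d) := by
  rcases Nat.eq_zero_or_pos t with rfl | ht
  · exact (hasSum_fintype _).summable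
  · refine summable_sum fun l hl => Summable.mul_left _ ?_
    simp_rw [Finset.prod_mul_distrib]
    refine Summable.mul_left _ ?_
    let i₀ : Fin t := ⟨t - 1, by omega⟩
    have hi₀ : (i₀ : ℕ) + 1 = t := by simp only [i₀]; omega
    refine .of_nonneg_of_le (fun c => Finset.prod_nonneg fun i _ => by positivity)
      (fun c => prod_one_div_pow_le (initSum_pos c) (fun i => l i) i₀
        (one_le_of_mem_support_headPoly d i₀ hi₀ (hd _ hi₀) hl)) ?_
    exact summable_prod_one_div_mul ht (fun c => initSum c)
      -- The bound `N` is the last partial sum, the largest of them.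
      (fun c c' h => incTuple_bijective.1 (Subtype.ext h)) initSum_pos _
      fun c i => (strictMono_initSum c).monotone (by rw [Fin.le_def]; omega)

theorem tendsto_tsum_headTerm_zero {t : ℕ} (d : Fin t → ℕ) (c : Fin t → ℕ) :
    Tendsto (fun q : ℝ => (1 - q) ^ (∑ i, (d i + 1)) * ∑' u, headTerm d q 0 (u, c)) (𝓝[<] 1)
      (𝓝 (xiTerm d (incTuple c))) := by
  rw [xiTerm_eq_sum]
  have h := tendsto_finsetSum (headPoly d).support fun l _ =>
    (tendsto_finsetProd Finset.univ fun i _ =>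
      tendsto_powSum (l := l i) (initSum_pos c i)).const_mul (((headPoly d).coeff l : ℚ) : ℝ)
  refine h.congr' ?_
  filter_upwards [eventually_mem_Ioo] with q ⟨h0, h1⟩
  rw [one_sub_pow_mul_tsum_headTerm_zero d h0 h1]

theorem tsum_headTerm_zero_nonneg {t : ℕ} (d : Fin t → ℕ) {q : ℝ} (h0 : 0 < q) (h1 : q < 1)
    (c : Fin t → ℕ) : 0 ≤ (1 - q) ^ (∑ i, (d i + 1)) * ∑' u, headTerm d q 0 (u, c) :=
  mul_nonneg (pow_nonneg (by linarith) _) (tsum_nonneg fun _ => headTerm_nonneg d h0 0 _)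

theorem summable_xiTerm {t : ℕ} (d : Fin t → ℕ)
    (hd : ∀ i : Fin t, (i : ℕ) + 1 = t → 1 ≤ d i) : Summable (xiTerm d) := by
  rw [← (Equiv.ofBijective _ (incTuple_bijective (t := t))).summable_iff]
  refine .of_nonneg_of_le (fun c => (xiTerm_pos d _).le) (fun c => ?_) (summable_headBound d hd)
  refine le_of_tendsto (tendsto_tsum_headTerm_zero d c) ?_
  filter_upwards [eventually_mem_Ioo] with q ⟨h0, h1⟩ using le_headBound d h0 h1 c

theorem xi_eq_tsum {t : ℕ} (d : Fin t → ℕ) : xi d = ∑' c, xiTerm d (incTuple c) :=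
  ((Equiv.ofBijective _ (incTuple_bijective (t := t))).tsum_eq _).symm

theorem summable_prod_pow_mul_headTerm {t : ℕ} (d : Fin t → ℕ) {q : ℝ} (h0 : 0 < q) (h1 : q < 1)
    (M : ℕ) : Summable fun uc => (∏ j, (q ^ M) ^ (uc.2 j + 1)) * headTerm d q 0 uc :=
  .of_nonneg_of_le
    (fun uc => mul_nonneg (Finset.prod_nonneg fun _ _ => by positivity) (headTerm_nonneg d h0 0 uc))
    (headTerm_zero_le d h0 M) (summable_headTerm d h0 h1 M)

/-- Dominated convergence over `c`, after summing over `u`. The extra factor is at most `1` and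
tends to `1` for each fixed `c`, so the majorant `headBound` serves for every `M`. -/
theorem tendsto_tsum_prod_pow_mul_headTerm {t : ℕ} (d : Fin t → ℕ)
    (hd : ∀ i : Fin t, (i : ℕ) + 1 = t → 1 ≤ d i) (M : ℕ) :
    Tendsto (fun q : ℝ => (1 - q) ^ (∑ i, (d i + 1)) *
        ∑' uc, (∏ j, (q ^ M) ^ (uc.2 j + 1)) * headTerm d q 0 uc) (𝓝[<] 1) (𝓝 (xi d)) := by
  rw [xi_eq_tsum]
  have h := tendsto_tsum_of_dominated_convergence (𝓕 := 𝓝[<] (1 : ℝ))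
    (f := fun (q : ℝ) (c : Fin t → ℕ) => (∏ j, (q ^ M) ^ (c j + 1)) *
      ((1 - q) ^ (∑ i, (d i + 1)) * ∑' u, headTerm d q 0 (u, c)))
    (g := fun c => xiTerm d (incTuple c)) (summable_headBound d hd) ?_ ?_
  · refine h.congr' ?_
    filter_upwards [eventually_mem_Ioo] with q ⟨h0, h1⟩
    have hs := summable_prod_pow_mul_headTerm d h0 h1 M
    have he := ((Equiv.prodComm (Fin t → ℕ) (Fin t → ℕ)).tsum_eq fun uc => (∏ j, (q ^ M) ^ (uc.2 j + 1)) *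
      headTerm d q 0 uc).symm.trans ((Equiv.prodComm _ _).summable_iff.mpr hs).tsum_prod
    rw [he, ← tsum_mul_left]
    refine tsum_congr fun c => ?_
    simp only [Equiv.prodComm_apply, Prod.swap_prod_mk, Function.comp]
    rw [tsum_mul_left]
    ring
  · intro c
    have h1 : Tendsto (fun q : ℝ => ∏ j, (q ^ M) ^ (c j + 1)) (𝓝[<] 1) (𝓝 1) := by
      have : Continuous (fun q : ℝ => ∏ j, (q ^ M) ^ (c j + 1)) := by fun_prop
      simpa using (this.tendsto 1).mono_left nhdsWithin_le_nhds
    simpa using h1.mul (tendsto_tsum_headTerm_zero d c)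
  · filter_upwards [eventually_mem_Ioo] with q ⟨h0, h1⟩ c
    have h2 : 0 ≤ ∏ j, (q ^ M) ^ (c j + 1) := Finset.prod_nonneg fun _ _ => by positivity
    have h3 : ∏ j, (q ^ M) ^ (c j + 1) ≤ 1 :=
      Finset.prod_le_one (fun _ _ => by positivity) fun _ _ =>
        pow_le_one₀ (by positivity) (pow_le_one₀ h0.le h1.le)
    have h4 := tsum_headTerm_zero_nonneg d h0 h1 c
    rw [Real.norm_of_nonneg (mul_nonneg h2 h4)]
    exact (mul_le_of_le_one_left h4 h3).trans (le_headBound d h0 h1 c)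

/-- The two bounds by sums at `M = 0`, with and without the damping factor, have the same limit, so
the shift by `M` is invisible. -/
theorem tendsto_tsum_headTerm {t : ℕ} (d : Fin t → ℕ)
    (hd : ∀ i : Fin t, (i : ℕ) + 1 = t → 1 ≤ d i) (M : ℕ) :
    Tendsto (fun q : ℝ => (1 - q) ^ (∑ i, (d i + 1)) * ∑' uc, headTerm d q M uc) (𝓝[<] 1)
      (𝓝 (xi d)) := by
  have hhi := tendsto_tsum_prod_pow_mul_headTerm d hd 0
  simp only [pow_zero, one_pow, Finset.prod_const_one, one_mul] at hhi
  refine tendsto_of_tendsto_of_tendsto_of_le_of_le'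
    (tendsto_tsum_prod_pow_mul_headTerm d hd M) hhi ?_ ?_
  · filter_upwards [eventually_mem_Ioo] with q ⟨h0, h1⟩
    exact mul_le_mul_of_nonneg_left ((summable_prod_pow_mul_headTerm d h0 h1 M).tsum_le_tsum
      (headTerm_zero_le d h0 M) (summable_headTerm d h0 h1 M)) (pow_nonneg (by linarith) _)
  · filter_upwards [eventually_mem_Ioo] with q ⟨h0, h1⟩
    exact mul_le_mul_of_nonneg_left (tsum_headTerm_le d h0 h1 M) (pow_nonneg (by linarith) _)

/-- The case `M = 0` dominates all others, so a single neighbourhood of `1` works for all `M`, as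
domination over `m` requires. -/
theorem eventually_norm_tsum_headTerm_le {t : ℕ} (d : Fin t → ℕ)
    (hd : ∀ i : Fin t, (i : ℕ) + 1 = t → 1 ≤ d i) :
    ∀ᶠ q : ℝ in 𝓝[<] 1, ∀ M,
      ‖(1 - q) ^ (∑ i, (d i + 1)) * ∑' uc, headTerm d q M uc‖ ≤ xi d + 1 := by
  filter_upwards [eventually_mem_Ioo,
    (tendsto_tsum_headTerm d hd 0).eventually_le_const (lt_add_one (xi d))] with q ⟨h0, h1⟩ hq M
  have hp : 0 ≤ (1 - q) ^ (∑ i, (d i + 1)) := pow_nonneg (by linarith) _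
  rw [Real.norm_of_nonneg (mul_nonneg hp (tsum_nonneg (headTerm_nonneg d h0 M)))]
  exact (mul_le_mul_of_nonneg_left (tsum_headTerm_le d h0 h1 M) hp).trans hq

/-! ### The limit and the degree -/

theorem tendsto_tsum_expTerm {F : ℕ → Polynomial ℚ} (hF : WellNormalized F) {t s : ℕ}
    (d : Fin t → ℕ) (k : Fin s → ℕ) (hd : ∀ i : Fin t, (i : ℕ) + 1 = t → 1 ≤ d i)
    (hk : ∀ i, 1 ≤ k i) (hk_first : ∀ i : Fin s, (i : ℕ) = 0 → 2 ≤ k i) :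
    Tendsto (fun q : ℝ => (1 - q) ^ ((∑ i, (d i + 1)) + ∑ i, k i) *
      ∑' x, expTerm (Fin.append d (fun _ : Fin s => 0))
        (fun j => incr (F (Fin.append (fun _ : Fin t => 1) k j))) q x)
      (𝓝[<] 1) (𝓝 (xi d * zeta k)) := by
  have hC : ∀ j, ∃ C : ℝ, 0 ≤ C ∧ ∀ m : ℕ, 1 ≤ m → ∀ q : ℝ, 0 < q → q < 1 →
      ‖(1 - q) ^ k j * incrSum (F (k j)) (q ^ m)‖ ≤ C * (1 / (m : ℝ) ^ k j) := fun j => by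
    have := exists_incrSum_le (F (k j)) (hF.eval_zero _ (hk j))
      (by rw [hF.natDegree_eq]; exact hk j)
    rwa [hF.natDegree_eq] at this
  choose C hC0 hC using hC
  have hlim : ∀ j (m : ℕ), 1 ≤ m → Tendsto (fun q : ℝ => (1 - q) ^ k j * incrSum (F (k j)) (q ^ m))
      (𝓝[<] 1) (𝓝 (1 / (m : ℝ) ^ k j)) := fun j m hm => by
    have := tendsto_incrSum (F (k j)) (hF.eval_zero _ (hk j)) hm
    rw [hF.natDegree_eq, hF.leadingCoeff_eq,
      mul_one_div_cancel (by exact_mod_cast Nat.factorial_ne_zero _), Rat.cast_one, one_mul] at this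
    exact this
  -- Dominated convergence over the last entries `m`: the power of `1 - q` is split between the two
  -- blocks, each of which has a pointwise limit and a bound uniform in `q` near `1`.
  have h := tendsto_tsum_of_dominated_convergence (𝓕 := 𝓝[<] (1 : ℝ))
    (f := fun (q : ℝ) (m : DecTuple s) =>
      (∏ j, ((1 - q) ^ k j * incrSum (F (k j)) (q ^ m.1 j))) *
        ((1 - q) ^ (∑ i, (d i + 1)) * ∑' uc, headTerm d q (top m) uc))
    (g := fun m => zetaTerm k m * xi d)
    (bound := fun m => ((∏ j, C j) * zetaTerm k m) * (xi d + 1))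
    (((summable_zetaTerm k hk hk_first).mul_left _).mul_right _) ?_ ?_
  · rw [tsum_mul_right, mul_comm] at h
    refine h.congr' ?_
    filter_upwards [eventually_mem_Ioo] with q ⟨h0, h1⟩
    rw [tsum_expTerm hF d k h0 h1, ← tsum_mul_left]
    refine tsum_congr fun m => ?_
    rw [Finset.prod_mul_distrib, Finset.prod_pow_eq_pow_sum, pow_add]
    ring
  · intro m
    exact (tendsto_finsetProd _ fun j _ => hlim j _ (m.2.2 j)).mul (tendsto_tsum_headTerm d hd _)
  · filter_upwards [eventually_mem_Ioo, eventually_norm_tsum_headTerm_le d hd]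
      with q ⟨h0, h1⟩ hq m
    rw [norm_mul, norm_prod, zetaTerm, ← Finset.prod_mul_distrib]
    refine mul_le_mul (Finset.prod_le_prod (fun _ _ => norm_nonneg _) fun j _ =>
      hC j _ (m.2.2 j) q h0 h1) (hq _) (norm_nonneg _)
      (Finset.prod_nonneg fun j _ => mul_nonneg (hC0 j) (by positivity))

/-- If a smaller exponent `a` also gave convergence, multiplying by `(1 - q)^(n - a) → 0` would
force `L = 0`. -/
theorem degree_eq_of_tendsto {f : Ptn → ℚ} {n : ℕ} {L : ℝ} (hL : L ≠ 0)
    (hs : ∀ q : ℝ, 0 < q → q < 1 → Summable (qBracketTerm f q))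
    (h : Tendsto (fun q : ℝ => (1 - q) ^ n * qBracketAt f q) (𝓝[<] 1) (𝓝 L)) :
    degree f = ((n : ℝ) : EReal) := by
  refine le_antisymm (sInf_le ⟨n, rfl, hs, L, by simpa only [Real.rpow_natCast] using h⟩) ?_
  refine le_sInf ?_
  rintro _ ⟨a, rfl, -, l, hl⟩
  rw [EReal.coe_le_coe_iff]
  by_contra! han
  have h1 : Tendsto (fun q : ℝ => (1 - q) ^ ((n : ℝ) - a)) (𝓝[<] 1) (𝓝 0) := by
    have hc : Continuous fun q : ℝ => (1 - q) ^ ((n : ℝ) - a) :=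
      (continuous_const.sub continuous_id).rpow_const fun _ => Or.inr (by linarith)
    have := (hc.tendsto 1).mono_left (nhdsWithin_le_nhds (s := Set.Iio 1))
    rwa [sub_self, Real.zero_rpow (by linarith)] at this
  have h2 := h1.mul hl
  rw [zero_mul] at h2
  refine hL (tendsto_nhds_unique h (h2.congr' ?_))
  filter_upwards [eventually_mem_Ioo] with q ⟨h0, hq1⟩
  rw [← mul_assoc, ← Real.rpow_add (by linarith), sub_add_cancel, Real.rpow_natCast]

theorem xi_pos {t : ℕ} (d : Fin t → ℕ) (hd : ∀ i : Fin t, (i : ℕ) + 1 = t → 1 ≤ d i) :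
    0 < xi d :=
  (summable_xiTerm d hd).tsum_pos (fun m => (xiTerm_pos d m).le) (incTuple 0) (xiTerm_pos d _)

theorem zeta_pos {s : ℕ} (k : Fin s → ℕ) (hk : ∀ i, 1 ≤ k i)
    (hk_first : ∀ i : Fin s, (i : ℕ) = 0 → 2 ≤ k i) : 0 < zeta k :=
  (summable_zetaTerm k hk hk_first).tsum_pos (fun m => (zetaTerm_pos k m).le) (shiftTuple 0 0)
    (zetaTerm_pos k _)

end PartitionMZV

theorem mainTheorem9 (F : ℕ → Polynomial ℚ) (hF : PartitionMZV.WellNormalized F)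
    (t s : ℕ) (d : Fin t → ℕ) (k : Fin s → ℕ)
    (hd : ∀ i : Fin t, (i : ℕ) + 1 = t → 1 ≤ d i)
    (hk : ∀ i : Fin s, 1 ≤ k i)
    (hk_first : ∀ i : Fin s, (i : ℕ) = 0 → 2 ≤ k i) :
    PartitionMZV.degree
        (PartitionMZV.P F (Fin.append (fun _ : Fin t => 1) k) (Fin.append d (fun _ : Fin s => 0)))
      = ((((∑ i, (d i + 1)) + (∑ i, k i) : ℕ) : ℝ) : EReal) ∧
    Summable (fun m : PartitionMZV.IncTuple t => PartitionMZV.xiTerm d m) ∧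
    Summable (fun m : PartitionMZV.DecTuple s => PartitionMZV.zetaTerm k m) ∧
    PartitionMZV.IsDegreeLimit
        (PartitionMZV.P F (Fin.append (fun _ : Fin t => 1) k) (Fin.append d (fun _ : Fin s => 0)))
      ((PartitionMZV.xi d * PartitionMZV.zeta k : ℝ) : EReal) := by
  have hF0 : ∀ j, (F (Fin.append (fun _ : Fin t => 1) k j)).eval 0 = 0 := by
    intro j
    refine hF.eval_zero _ (Fin.addCases (fun j => ?_) (fun j => ?_) j)
    · rw [Fin.append_left]
    · rw [Fin.append_right]; exact hk j
  have hsum := fun {q : ℝ} (h0 : 0 < q) (h1 : q < 1) =>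
    PartitionMZV.hasSum_qBracketTerm_P F (Fin.append (fun _ : Fin t => 1) k)
      (Fin.append d (fun _ : Fin s => 0)) hF0 h0 h1
  have hlim := (PartitionMZV.tendsto_tsum_expTerm hF d k hd hk hk_first).congr' <| by
    filter_upwards [PartitionMZV.eventually_mem_Ioo] with q ⟨h0, h1⟩
    rw [← (hsum h0 h1).tsum_eq]
  -- All terms of `xi` and `zeta` are positive, so the limit is nonzero.
  have hdeg := PartitionMZV.degree_eq_of_tendsto
    (mul_pos (PartitionMZV.xi_pos d hd) (PartitionMZV.zeta_pos k hk hk_first)).ne'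
    (fun q h0 h1 => (hsum h0 h1).summable) hlim
  refine ⟨hdeg, PartitionMZV.summable_xiTerm d hd, PartitionMZV.summable_zetaTerm k hk hk_first,
    _, hdeg, ?_⟩
  simp only [Real.rpow_natCast]
  exact (continuous_coe_real_ereal.tendsto _).comp hlim
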